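/- Let $n\ge 1$ and let $J=\begin{pmatrix}0&I\\-I&0\end{pmatrix}$ be of size $2n\times 2n$. By Williamson's theorem, for every real symmetric positive definite $2n\times 2n$ matrix $A$ there are a real symplectic matrix $M$ (that is, $M^TJM=J$) and a unique $n$-tuple of positive numbers $d_1(A)\le\cdots\le d_n(A)$, the symplectic eigenvalues of $A$, such that $M^TAM=\begin{pmatrix}D&0\\0&D\end{pmatrix}$ with $D=\mathrm{diag}(d_1(A),\dots,d_n(A))$. Let $\widehat D(A)$ be the $2n\times 2n$ diagonal matrix whose diagonal lists the symplectic eigenvalues of $A$, each counted twice, in decreasing order. Write $|X|=(X^TX)^{1/2}$ for the absolute value of a real matrix $X$ and $\|\cdot\|$ for the operator norm induced by the Euclidean norm. Let $A,B$ be real symmetric positive definite $2n\times 2n$ matrices. Then for every unitarily invariant norm $|||\cdot|||$ on the real or complex $2n\times 2n$ matrices (that is, every norm with $|||UXV|||=|||X|||$ for all $X$ and all unitary $U,V$, where unitary means orthogonal in the real case), $$|||\widehat D(A)-\widehat D(B)|||\le\left(\|A\|^{1/2}+\|B\|^{1/2}\right)\,|||\,|A-B|^{1/2}\,|||.$$ Moreover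 (the special cases of the operator norm and the Frobenius norm) $$\max_{1\le j\le n}|d_j(A)-d_j(B)|\le\left(\|A\|^{1/2}+\|B\|^{1/2}\right)\|A-B\|^{1/2},$$ $$\sqrt2\left(\sum_{j=1}^n|d_j(A)-d_j(B)|^2\right)^{1/2}\le\left(\|A\|^{1/2}+\|B\|^{1/2}\right)\left(\mathrm{tr}\,|A-B|\right)^{1/2}.$$ -/

import Mathlib

open scoped Matrix MatrixOrder Matrix.Norms.L2Operator

/-- `d` lists the symplectic eigenvalues of the real `2n × 2n` matrix `A` in increasing order:
the entries of `d` are positive and increasing, and `Mᵀ A M = diag(D, D)` with `D = diag(d)`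
for some real symplectic matrix `M`. -/
def IsSymplecticSpectrum {n : ℕ} (A : Matrix (Fin n ⊕ Fin n) (Fin n ⊕ Fin n) ℝ)
    (d : Fin n → ℝ) : Prop :=
  Monotone d ∧ (∀ j, 0 < d j) ∧
    ∃ M ∈ Matrix.symplecticGroup (Fin n) ℝ,
      Mᵀ * A * M = Matrix.fromBlocks (Matrix.diagonal d) 0 0 (Matrix.diagonal d)

open Classical in
/-- The symplectic eigenvalues `d₁(A) ≤ ⋯ ≤ dₙ(A)` (indexed from `0`). For `A` positive definite
the list `d` exists and is unique (Williamson's theorem); the value `0` is used only for matrices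
that have no such list. -/
noncomputable def symplecticEigenvalues {n : ℕ} (A : Matrix (Fin n ⊕ Fin n) (Fin n ⊕ Fin n) ℝ) :
    Fin n → ℝ :=
  if h : ∃ d, IsSymplecticSpectrum A d then h.choose else 0

/-- The vector of the `2n` numbers consisting of the symplectic eigenvalues of `A`, each counted
twice, in decreasing order: `(dₙ, dₙ, dₙ₋₁, dₙ₋₁, …, d₁, d₁)`. -/
noncomputable def dHat {n : ℕ} (A : Matrix (Fin n ⊕ Fin n) (Fin n ⊕ Fin n) ℝ) :
    Fin (n + n) → ℝ :=
  fun k => symplecticEigenvalues A (Fin.rev ⟨k.val / 2, by omega⟩)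

/-- The `2n × 2n` diagonal matrix whose diagonal is `dHat A`; the rows and columns indexed by
`Fin n ⊕ Fin n` are enumerated in the usual order, the first block before the second. -/
noncomputable def DHat {n : ℕ} (A : Matrix (Fin n ⊕ Fin n) (Fin n ⊕ Fin n) ℝ) :
    Matrix (Fin n ⊕ Fin n) (Fin n ⊕ Fin n) ℝ :=
  Matrix.diagonal fun i => dHat A (finSumFinEquiv i)

/-- A seminorm on the space of square matrices over `𝕜` (`ℝ` or `ℂ`) is a unitarily invariant
norm if it is definite and `N (U X V) = N X` for all unitary (for `𝕜 = ℝ`: orthogonal) `U, V`. -/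
def IsUnitarilyInvariantNorm {𝕜 : Type*} [RCLike 𝕜] {m : Type*} [Fintype m] [DecidableEq m]
    (N : Seminorm 𝕜 (Matrix m m 𝕜)) : Prop :=
  (∀ X, N X = 0 → X = 0) ∧
    ∀ U ∈ Matrix.unitaryGroup m 𝕜, ∀ V ∈ Matrix.unitaryGroup m 𝕜, ∀ X, N (U * X * V) = N X

/-! Write S = √A and T = √B. The symplectic eigenvalues of A can be read off the skew-symmetric
matrix K_A = S J S: it is orthogonally similar to `skewBlock d`, so i·K_A is Hermitian with
eigenvalues ±d_j (`IsSymplecticSpectrum.exists_skewBlock`, `diagConj_map_mul_skewBlockUnitary`).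
Three estimates then combine in `IsOrthogonallyInvariant.DHat_sub_le`.

The Lidskii–Mirsky–Wielandt theorem for i·K_A and i·K_B (`sum_eigenvalue_sub_excess_le`) says that
the differences of symplectic eigenvalues, each taken twice, are weakly majorized by the singular
values of K_A - K_B. Fan dominance (`IsOrthogonallyInvariant.diagonal_le_of_excess`) turns this into
|||D̂(A) - D̂(B)||| ≤ |||K_A - K_B|||.

Next, K_A - K_B = S J (S - T) + (S - T) J T, where J is orthogonal, ‖S‖ = ‖A‖^{1/2} and ‖T‖ =
‖B‖^{1/2}; this leaves the factor |||S - T|||.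

Finally |||√A - √B||| ≤ ||| |A - B|^{1/2} ||| (`IsOrthogonallyInvariant.sqrt_sub_sqrt_le`), again by
Fan dominance.

Weak majorization is expressed throughout by ∑ max(x_i - t, 0) ≤ ∑ max(y_i - t, 0) for all
thresholds t > 0. In this form it follows from operator inequalities and a single trace. -/

/-! ### Unitary diagonalization, Weyl monotonicity and Lidskii–Mirsky–Wielandt. -/

section Diagonalization

open scoped ComplexOrder

variable {𝕜 : Type*} [RCLike 𝕜] {m : Type*} [Fintype m] [DecidableEq m]

/-- The matrix with eigenvalues `a` and eigenvectors the columns of `U`. -/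
noncomputable def diagConj (U : Matrix m m 𝕜) (a : m → ℝ) : Matrix m m 𝕜 :=
  U * Matrix.diagonal (fun i => (a i : 𝕜)) * star U

theorem Matrix.unitaryGroup_star_mul_self {U : Matrix m m 𝕜} (hU : U ∈ Matrix.unitaryGroup m 𝕜) :
    star U * U = 1 := Matrix.mem_unitaryGroup_iff'.1 hU

theorem Matrix.unitaryGroup_mul_star_self {U : Matrix m m 𝕜} (hU : U ∈ Matrix.unitaryGroup m 𝕜) :
    U * star U = 1 := Matrix.mem_unitaryGroup_iff.1 hU

theorem Matrix.star_mem_unitaryGroup {U : Matrix m m 𝕜} (hU : U ∈ Matrix.unitaryGroup m 𝕜) :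
    star U ∈ Matrix.unitaryGroup m 𝕜 := Unitary.star_mem hU

theorem diagConj_add (U : Matrix m m 𝕜) (a b : m → ℝ) :
    diagConj U (a + b) = diagConj U a + diagConj U b := by
  simp only [diagConj, ← mul_add, ← add_mul, Matrix.diagonal_add, Pi.add_apply, RCLike.ofReal_add]

theorem diagConj_neg (U : Matrix m m 𝕜) (a : m → ℝ) : diagConj U (-a) = -diagConj U a := by
  have : (Matrix.diagonal fun i => (((-a) i : ℝ) : 𝕜)) = -Matrix.diagonal fun i => ((a i : ℝ) : 𝕜) := by
    ext i j; by_cases h : i = j <;> simp [Matrix.diagonal, h]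
  simp only [diagConj, this, mul_neg, neg_mul]

theorem diagConj_sub (U : Matrix m m 𝕜) (a b : m → ℝ) :
    diagConj U (a - b) = diagConj U a - diagConj U b := by
  rw [sub_eq_add_neg, diagConj_add, diagConj_neg, sub_eq_add_neg]

theorem diagConj_const {U : Matrix m m 𝕜} (hU : U ∈ Matrix.unitaryGroup m 𝕜) (t : ℝ) :
    diagConj U (fun _ => t) = (t : 𝕜) • 1 := by
  have : (Matrix.diagonal fun _ : m => (t : 𝕜)) = (t : 𝕜) • 1 := by
    rw [Matrix.smul_one_eq_diagonal]
  simp [diagConj, this, Matrix.unitaryGroup_mul_star_self hU]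

theorem diagConj_mul {U : Matrix m m 𝕜} (hU : U ∈ Matrix.unitaryGroup m 𝕜) (a b : m → ℝ) :
    diagConj U a * diagConj U b = diagConj U (a * b) := by
  have h := Matrix.unitaryGroup_star_mul_self hU
  calc diagConj U a * diagConj U b
      = U * Matrix.diagonal (fun i => (a i : 𝕜)) * (star U * U) *
          Matrix.diagonal (fun i => (b i : 𝕜)) * star U := by simp only [diagConj, mul_assoc]
    _ = diagConj U (a * b) := by
      rw [h, mul_one, mul_assoc U, Matrix.diagonal_mul_diagonal]; simp [diagConj]

theorem diagConj_posSemidef (U : Matrix m m 𝕜) {a : m → ℝ} (ha : ∀ i, 0 ≤ a i) :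
    (diagConj U a).PosSemidef := by
  refine Matrix.PosSemidef.mul_mul_conjTranspose_same (Matrix.PosSemidef.diagonal ?_) U
  intro i
  simpa using ha i

theorem diagConj_mono (U : Matrix m m 𝕜) {a b : m → ℝ} (h : ∀ i, a i ≤ b i) :
    diagConj U a ≤ diagConj U b := by
  rw [Matrix.le_iff, ← diagConj_sub]
  exact diagConj_posSemidef U fun i => sub_nonneg.2 (h i)

theorem diagConj_isHermitian (U : Matrix m m 𝕜) (a : m → ℝ) : (diagConj U a).IsHermitian := by
  refine Matrix.isHermitian_mul_mul_conjTranspose U ?_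
  exact Matrix.isHermitian_diagonal_of_self_adjoint _ (by ext i; simp)

theorem diagConj_trace {U : Matrix m m 𝕜} (hU : U ∈ Matrix.unitaryGroup m 𝕜) (a : m → ℝ) :
    (diagConj U a).trace = ((∑ i, a i : ℝ) : 𝕜) := by
  rw [diagConj, Matrix.trace_mul_comm, ← mul_assoc, Matrix.unitaryGroup_star_mul_self hU, one_mul,
    Matrix.trace_diagonal]
  simp

theorem Matrix.IsHermitian.exists_diagConj {X : Matrix m m 𝕜} (hX : X.IsHermitian) :
    ∃ U ∈ Matrix.unitaryGroup m 𝕜, ∃ a : m → ℝ, X = diagConj U a := by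
  refine ⟨hX.eigenvectorUnitary, hX.eigenvectorUnitary.2, hX.eigenvalues, ?_⟩
  conv_lhs => rw [hX.spectral_theorem]
  rw [Unitary.conjStarAlgAut_apply]
  rfl

theorem diagConj_submatrix (U : Matrix m m 𝕜) (a : m → ℝ) (σ : Equiv.Perm m) :
    diagConj (U.submatrix id σ) (a ∘ σ) = diagConj U a := by
  ext i j
  simp only [diagConj, Matrix.mul_apply, Matrix.diagonal_apply, Matrix.submatrix_apply, id,
    Matrix.star_apply, mul_ite, mul_zero, Finset.sum_ite_eq', Finset.mem_univ, if_true,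
    Function.comp]
  exact Equiv.sum_comp σ fun k => U i k * (a k : 𝕜) * star (U j k)

theorem Matrix.unitaryGroup_submatrix {U : Matrix m m 𝕜} (hU : U ∈ Matrix.unitaryGroup m 𝕜)
    (σ : Equiv.Perm m) : U.submatrix id σ ∈ Matrix.unitaryGroup m 𝕜 := by
  rw [Matrix.mem_unitaryGroup_iff'] at hU ⊢
  have : star (U.submatrix id σ) * U.submatrix id σ = (star U * U).submatrix σ σ := by
    ext i j; simp [Matrix.mul_apply]
  rw [this, hU, Matrix.submatrix_one_equiv]

/-- A Hermitian matrix has a diagonalization whose eigenvalues decrease along a given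
enumeration of the indices. -/
theorem Matrix.IsHermitian.exists_diagConj_antitone {X : Matrix m m 𝕜} (hX : X.IsHermitian)
    {N : ℕ} (f : m ≃ Fin N) :
    ∃ U ∈ Matrix.unitaryGroup m 𝕜, ∃ a : m → ℝ, X = diagConj U a ∧ ∀ i j, f i ≤ f j → a j ≤ a i := by
  obtain ⟨U, hU, a, rfl⟩ := hX.exists_diagConj
  let g : Fin N → ℝ := fun k => -a (f.symm k)
  let σ : Equiv.Perm m := (f.trans (Tuple.sort g)).trans f.symm
  refine ⟨U.submatrix id σ, Matrix.unitaryGroup_submatrix hU σ, a ∘ σ,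
    (diagConj_submatrix U a σ).symm, fun i j hij => ?_⟩
  have := Tuple.monotone_sort g hij
  simpa [g, σ] using this

theorem diagConj_quadratic {U : Matrix m m 𝕜} (hU : U ∈ Matrix.unitaryGroup m 𝕜) (a : m → ℝ)
    (x : m → 𝕜) :
    star (U *ᵥ x) ⬝ᵥ (diagConj U a *ᵥ (U *ᵥ x)) = ((∑ i, a i * ‖x i‖ ^ 2 : ℝ) : 𝕜) := by
  have h : diagConj U a *ᵥ (U *ᵥ x) = U *ᵥ (Matrix.diagonal (fun i => (a i : 𝕜)) *ᵥ x) := by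
    rw [Matrix.mulVec_mulVec, diagConj, mul_assoc, Matrix.unitaryGroup_star_mul_self hU, mul_one,
      Matrix.mulVec_mulVec]
  rw [h, Matrix.star_mulVec, Matrix.dotProduct_mulVec, Matrix.vecMul_vecMul,
    ← Matrix.star_eq_conjTranspose, Matrix.unitaryGroup_star_mul_self hU, Matrix.vecMul_one]
  simp only [dotProduct, Pi.star_apply, Matrix.mulVec_diagonal, RCLike.star_def, map_sum,
    RCLike.ofReal_mul, RCLike.ofReal_pow]
  refine Finset.sum_congr rfl fun i _ => ?_
  rw [← RCLike.conj_mul]; ring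

theorem unitary_mulVec_norm_sq {U : Matrix m m 𝕜} (hU : U ∈ Matrix.unitaryGroup m 𝕜)
    (x : m → 𝕜) : star (U *ᵥ x) ⬝ᵥ (U *ᵥ x) = ((∑ i, ‖x i‖ ^ 2 : ℝ) : 𝕜) := by
  have := diagConj_quadratic hU (fun _ => 1) x
  rw [diagConj_const hU] at this
  simpa using this

/-- Two coordinate subspaces (in two bases) of total dimension larger than that of the
space intersect nontrivially. -/
theorem exists_common_vector {U V : Matrix m m 𝕜} (hV : V ∈ Matrix.unitaryGroup m 𝕜)
    (hU : U ∈ Matrix.unitaryGroup m 𝕜)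
    {S T : Finset m} (hST : Fintype.card m < S.card + T.card) :
    ∃ x y : m → 𝕜, U *ᵥ x = V *ᵥ y ∧ x ≠ 0 ∧ (∀ i ∉ S, x i = 0) ∧ ∀ i ∉ T, y i = 0 := by
  let eS : (S → 𝕜) →ₗ[𝕜] (m → 𝕜) := Function.ExtendByZero.linearMap 𝕜 (Subtype.val : S → m)
  let eT : (T → 𝕜) →ₗ[𝕜] (m → 𝕜) := Function.ExtendByZero.linearMap 𝕜 (Subtype.val : T → m)
  -- The map (p, q) ↦ U p - V q has a source of dimension |S| + |T|, too large for injectivity; a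
  -- nonzero kernel element is the required pair.
  let F : ((S → 𝕜) × (T → 𝕜)) →ₗ[𝕜] (m → 𝕜) :=
    (U.mulVecLin ∘ₗ eS).coprod (-(V.mulVecLin ∘ₗ eT))
  have hF : ¬ Function.Injective F := by
    intro h
    have := LinearMap.finrank_le_finrank_of_injective h
    simp at this
    omega
  have hinjU : Function.Injective (U *ᵥ ·) := fun a b h => by
    have := congrArg (star U *ᵥ ·) h
    simpa [Matrix.mulVec_mulVec, Matrix.unitaryGroup_star_mul_self hU] using this
  have hinjV : Function.Injective (V *ᵥ ·) := fun a b h => by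
    have := congrArg (star V *ᵥ ·) h
    simpa [Matrix.mulVec_mulVec, Matrix.unitaryGroup_star_mul_self hV] using this
  have hS0 : ∀ p : S → 𝕜, eS p = 0 → p = 0 := fun p hp => by
    ext i
    exact (Subtype.val_injective.extend_apply p 0 i).symm.trans (congrFun hp i)
  have hT0 : ∀ p : T → 𝕜, eT p = 0 → p = 0 := fun p hp => by
    ext i
    exact (Subtype.val_injective.extend_apply p 0 i).symm.trans (congrFun hp i)
  rw [← LinearMap.ker_eq_bot, Submodule.eq_bot_iff] at hF
  push Not at hF
  obtain ⟨⟨p, q⟩, hpq, hne⟩ := hF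
  have hUV : U *ᵥ eS p = V *ᵥ eT q := by
    have : F (p, q) = 0 := hpq
    simpa [F, LinearMap.coprod_apply, add_neg_eq_zero] using this
  refine ⟨eS p, eT q, hUV, fun h0 => hne ?_, fun i hi => ?_, fun i hi => ?_⟩
  · have hq : eT q = 0 := hinjV (by simpa [h0] using hUV.symm)
    rw [Prod.mk_eq_zero]
    exact ⟨hS0 p h0, hT0 q hq⟩
  · simp only [eS, Function.ExtendByZero.linearMap]
    exact Function.extend_apply' _ _ _ (by rintro ⟨a, rfl⟩; exact hi a.2)
  · simp only [eT, Function.ExtendByZero.linearMap]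
    exact Function.extend_apply' _ _ _ (by rintro ⟨a, rfl⟩; exact hi a.2)

/-- The dimension count behind min-max: a nonzero vector lying both in the span of the eigenvectors
indexed by `S` and in that of those indexed by `T` has quadratic form at least α‖·‖² for the smaller
matrix and at most β‖·‖² for the larger. -/
theorem diagConj_le_card {U V : Matrix m m 𝕜} (hU : U ∈ Matrix.unitaryGroup m 𝕜)
    (hV : V ∈ Matrix.unitaryGroup m 𝕜) {a b : m → ℝ} (h : diagConj U a ≤ diagConj V b)
    {S T : Finset m} (hST : Fintype.card m < S.card + T.card) {α β : ℝ}
    (hα : ∀ i ∈ S, α ≤ a i) (hβ : ∀ i ∈ T, b i ≤ β) : α ≤ β := by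
  obtain ⟨x, y, hxy, hx0, hxS, hyT⟩ := exists_common_vector hV hU hST
  have h1 := (Matrix.le_iff.1 h).dotProduct_mulVec_nonneg (U *ᵥ x)
  rw [Matrix.sub_mulVec, dotProduct_sub, diagConj_quadratic hU, hxy, diagConj_quadratic hV,
    ← RCLike.ofReal_sub, RCLike.ofReal_nonneg, sub_nonneg] at h1
  have h2 : ∑ i, ‖x i‖ ^ 2 = ∑ i, ‖y i‖ ^ 2 := by
    have := unitary_mulVec_norm_sq hU x
    rw [hxy, unitary_mulVec_norm_sq hV y] at this
    exact_mod_cast this.symm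
  have h3 : α * ∑ i, ‖x i‖ ^ 2 ≤ ∑ i, a i * ‖x i‖ ^ 2 := by
    rw [Finset.mul_sum]
    refine Finset.sum_le_sum fun i _ => ?_
    by_cases hi : i ∈ S
    · exact mul_le_mul_of_nonneg_right (hα i hi) (by positivity)
    · simp [hxS i hi]
  have h4 : ∑ i, b i * ‖y i‖ ^ 2 ≤ β * ∑ i, ‖y i‖ ^ 2 := by
    rw [Finset.mul_sum]
    refine Finset.sum_le_sum fun i _ => ?_
    by_cases hi : i ∈ T
    · exact mul_le_mul_of_nonneg_right (hβ i hi) (by positivity)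
    · simp [hyT i hi]
  have h5 : 0 < ∑ i, ‖x i‖ ^ 2 := by
    obtain ⟨i, hi⟩ := Function.ne_iff.1 hx0
    refine Finset.sum_pos' (fun _ _ => by positivity) ⟨i, Finset.mem_univ i, ?_⟩
    have : 0 < ‖x i‖ := norm_pos_iff.2 hi
    positivity
  rw [← h2] at h4
  exact le_of_mul_le_mul_right (h3.trans (h1.trans h4)) h5

/-- **Weyl's monotonicity theorem**. -/
theorem eigenvalue_le_of_le {U V : Matrix m m 𝕜} (hU : U ∈ Matrix.unitaryGroup m 𝕜)
    (hV : V ∈ Matrix.unitaryGroup m 𝕜) {a b : m → ℝ} (h : diagConj U a ≤ diagConj V b)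
    {N : ℕ} (f : m ≃ Fin N) (ha : ∀ i j, f i ≤ f j → a j ≤ a i)
    (hb : ∀ i j, f i ≤ f j → b j ≤ b i) (i : m) : a i ≤ b i := by
  have hN : Fintype.card m = N := by simpa using Fintype.card_congr f
  -- With k = `f i`, counted from 0, the two index sets have k + 1 and N - k elements, one more in
  -- total than the dimension.
  refine diagConj_le_card hU hV h (S := (Finset.Iic (f i)).map f.symm.toEmbedding)
    (T := (Finset.Ici (f i)).map f.symm.toEmbedding) ?_ ?_ ?_
  · rw [Finset.card_map, Finset.card_map, Fin.card_Iic, Fin.card_Ici, hN]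
    have := (f i).2
    omega
  · intro j hj
    obtain ⟨k, hk, rfl⟩ := Finset.mem_map.1 hj
    exact ha _ _ (by simpa using hk)
  · intro j hj
    obtain ⟨k, hk, rfl⟩ := Finset.mem_map.1 hj
    exact hb _ _ (by simpa using hk)

/-- A form of the Lidskii–Mirsky–Wielandt theorem: for decreasingly ordered eigenvalues
`a`, `b` of `X`, `Y`, the positive excess of `a - b` over a threshold is bounded by that of the
eigenvalues of `X - Y`. -/
theorem sum_eigenvalue_sub_excess_le {U V W : Matrix m m 𝕜} (hU : U ∈ Matrix.unitaryGroup m 𝕜)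
    (hV : V ∈ Matrix.unitaryGroup m 𝕜) (hW : W ∈ Matrix.unitaryGroup m 𝕜) {a b h : m → ℝ}
    (hH : diagConj U a - diagConj V b = diagConj W h)
    {N : ℕ} (f : m ≃ Fin N) (ha : ∀ i j, f i ≤ f j → a j ≤ a i)
    (hb : ∀ i j, f i ≤ f j → b j ≤ b i) (t : ℝ) :
    ∑ i, max (a i - b i - t) 0 ≤ ∑ i, max (h i - t) 0 := by
  set e : m → ℝ := fun i => max (h i - t) 0 with he
  -- Let X, Y be the two given matrices and E the positive part of (X - Y) - t. Then Y + E dominates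
  -- both Y and X - t, so by Weyl its eigenvalues `c` satisfy c ≥ b and c ≥ a - t. The sum of c - b
  -- is tr E, which is the right-hand side.
  obtain ⟨V', hV', c, hc, hcf⟩ := ((diagConj_isHermitian V b).add
    (diagConj_isHermitian W e)).exists_diagConj_antitone f
  have hbc : ∀ i, b i ≤ c i := eigenvalue_le_of_le hV hV' (by
    rw [← hc, le_add_iff_nonneg_right]
    exact (diagConj_posSemidef W fun i => le_max_right _ _).nonneg) f hb hcf
  have hac : ∀ i, a i ≤ c i + t := eigenvalue_le_of_le (b := c + fun _ => t) hU hV' (by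
    rw [diagConj_add, ← hc, diagConj_const hV', ← diagConj_const hW, add_assoc, ← diagConj_add,
      ← sub_le_iff_le_add', hH]
    refine diagConj_mono W fun i => ?_
    have := le_max_left (h i - t) 0
    simp only [Pi.add_apply, he]; linarith) f ha (fun i j hij => by
      have := hcf i j hij
      simpa using this)
  have htr : ∑ i, c i = ∑ i, b i + ∑ i, e i := by
    have := congrArg Matrix.trace hc
    rw [Matrix.trace_add, diagConj_trace hV, diagConj_trace hW, diagConj_trace hV',
      ← RCLike.ofReal_add] at this
    exact_mod_cast this.symm
  calc ∑ i, max (a i - b i - t) 0 ≤ ∑ i, (c i - b i) :=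
        Finset.sum_le_sum fun i _ => max_le (by linarith [hac i]) (by linarith [hbc i])
    _ = ∑ i, e i := by rw [Finset.sum_sub_distrib, htr]; ring

end Diagonalization

/-! ### Weak majorization and symmetric seminorms on vectors. -/

section Majorization

/-- Abel summation: if all partial sums of `w` are nonnegative, then so is the sum of `w` weighted
with nonnegative decreasing weights. -/
theorem sum_antitone_mul_nonneg {N : ℕ} (c w : Fin N → ℝ) (hc : Antitone c) (hc0 : ∀ i, 0 ≤ c i)
    (hw : ∀ k : Fin N, 0 ≤ ∑ i ∈ Finset.Iic k, w i) : 0 ≤ ∑ i, c i * w i := by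
  induction N with
  | zero => simp
  | succ N ih =>
    have hS : ∀ k : Fin N, ∑ i ∈ Finset.Iic k.castSucc, w i = ∑ i ∈ Finset.Iic k, w i.castSucc := by
      intro k
      rw [← Fin.map_castSuccEmb_Iic, Finset.sum_map]; rfl
    have htop : 0 ≤ ∑ i, w i := by
      have := hw (Fin.last N)
      rwa [show Finset.Iic (Fin.last N) = Finset.univ from Finset.Iic_top] at this
    -- Subtracting the last, smallest weight keeps the remaining weights nonnegative and decreasing;
    -- the subtracted constant multiplies the full sum of `w`.
    have := ih (fun i => c i.castSucc - c (Fin.last N)) (fun i => w i.castSucc)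
      (fun i j hij => sub_le_sub_right (hc (Fin.castSucc_le_castSucc_iff.2 hij)) _)
      (fun i => sub_nonneg.2 (hc (Fin.le_last _))) (fun k => by rw [← hS]; exact hw _)
    have h2 : ∑ i, c i * w i = ∑ i : Fin N, (c i.castSucc - c (Fin.last N)) * w i.castSucc +
        c (Fin.last N) * ∑ i, w i := by
      rw [Fin.sum_univ_castSucc, Fin.sum_univ_castSucc w, mul_add, Finset.mul_sum, ← add_assoc,
        ← Finset.sum_add_distrib]
      congr 1
      exact Finset.sum_congr rfl fun i _ => by ring
    rw [h2]
    exact add_nonneg this (mul_nonneg (hc0 _) htop)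

variable {m : Type*}

/-- The weak majorization of `x` by `y`, expressed by excesses over thresholds, bounds partial
sums of `x` by those of `y` in decreasing order. -/
theorem sum_le_sum_Iic_of_excess {N : ℕ} {x y : Fin N → ℝ}
    (hxy : ∀ t, 0 ≤ t → ∑ i, max (x i - t) 0 ≤ ∑ i, max (y i - t) 0)
    (hy : Antitone y) (hy0 : ∀ i, 0 ≤ y i) (k : Fin N) :
    ∑ i ∈ Finset.Iic k, x i ≤ ∑ i ∈ Finset.Iic k, y i := by
  -- At the threshold `y k` the positive excess of `y` is carried by the indices up to `k`, while
  -- any partial sum of `x` is bounded by its excess.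
  have h1 : ∑ i ∈ Finset.Iic k, (x i - y k) ≤ ∑ i, max (x i - y k) 0 :=
    (Finset.sum_le_sum fun i _ => le_max_left _ _).trans
      (Finset.sum_le_univ_sum_of_nonneg fun i => le_max_right _ _)
  have h2 : ∑ i, max (y i - y k) 0 = ∑ i ∈ Finset.Iic k, (y i - y k) := by
    rw [← Finset.sum_subset (Finset.subset_univ (Finset.Iic k))]
    · exact Finset.sum_congr rfl fun i hi =>
        max_eq_left (sub_nonneg.2 (hy (Finset.mem_Iic.1 hi)))
    · intro i _ hi
      exact max_eq_right (sub_nonpos.2 (hy (le_of_not_ge fun h => hi (Finset.mem_Iic.2 h))))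
  have := (h1.trans (hxy _ (hy0 k))).trans_eq h2
  simpa [Finset.sum_sub_distrib] using this

theorem exists_antitone_equiv {N : ℕ} (f : m ≃ Fin N) (c : m → ℝ) :
    ∃ g : Fin N ≃ m, Antitone (c ∘ g) := by
  refine ⟨(Tuple.sort fun k => -c (f.symm k)).trans f.symm, fun i j hij => ?_⟩
  have := Tuple.monotone_sort (fun k => -c (f.symm k)) hij
  simpa using this

variable [Fintype m]

/-- The excess at threshold `0` is controlled by the excesses at positive thresholds. -/
theorem excess_le_of_pos {x y : m → ℝ}
    (hxy : ∀ t, 0 < t → ∑ i, max (x i - t) 0 ≤ ∑ i, max (y i - t) 0) {t : ℝ} (ht : 0 ≤ t) :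
    ∑ i, max (x i - t) 0 ≤ ∑ i, max (y i - t) 0 := by
  have hc : ∀ z : m → ℝ, Filter.Tendsto (fun s => ∑ i, max (z i - s) 0) (nhdsWithin t (Set.Ioi t))
      (nhds (∑ i, max (z i - t) 0)) := fun z => by
    have : Continuous fun s => ∑ i, max (z i - s) 0 := by fun_prop
    exact this.continuousWithinAt
  refine le_of_tendsto_of_tendsto (hc x) (hc y) ?_
  filter_upwards [self_mem_nhdsWithin] with s hs
  exact hxy s (ht.trans_lt hs)

/-- A weak majorization inequality for weighted sums. -/
theorem exists_perm_sum_mul_le [DecidableEq m] {x y : m → ℝ} (hx0 : ∀ i, 0 ≤ x i)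
    (hy0 : ∀ i, 0 ≤ y i)
    (hxy : ∀ t, 0 < t → ∑ i, max (x i - t) 0 ≤ ∑ i, max (y i - t) 0) (c : m → ℝ) :
    ∃ σ : Equiv.Perm m, ∑ i, c i * x i ≤ ∑ i, |c i| * y (σ i) := by
  obtain ⟨g, hg⟩ := exists_antitone_equiv (Fintype.equivFin m) fun i => |c i|
  obtain ⟨h, hh⟩ := exists_antitone_equiv (Fintype.equivFin m) y
  refine ⟨g.symm.trans h, ?_⟩
  -- Only `y` has to be sorted here; `x` is enumerated in the order that makes the weights decrease.
  have h1 : ∀ k, ∑ i ∈ Finset.Iic k, x (g i) ≤ ∑ i ∈ Finset.Iic k, y (h i) :=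
    sum_le_sum_Iic_of_excess (x := x ∘ g) (y := y ∘ h) (fun t ht => by
      have e1 := Equiv.sum_comp g fun i => max (x i - t) 0
      have e2 := Equiv.sum_comp h fun i => max (y i - t) 0
      simp only [Function.comp]
      rw [e1, e2]
      exact excess_le_of_pos hxy ht) hh fun i => hy0 _
  have h2 := sum_antitone_mul_nonneg (fun i => |c (g i)|) (fun i => y (h i) - x (g i)) hg
    (fun _ => abs_nonneg _) fun k => by
      rw [Finset.sum_sub_distrib]; exact sub_nonneg.2 (h1 k)
  calc ∑ i, c i * x i ≤ ∑ i, |c i| * x i :=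
        Finset.sum_le_sum fun i _ => mul_le_mul_of_nonneg_right (le_abs_self _) (hx0 i)
    _ = ∑ k, |c (g k)| * x (g k) := (Equiv.sum_comp g fun i => |c i| * x i).symm
    _ ≤ ∑ k, |c (g k)| * y (h k) := by
      simp only [mul_sub, Finset.sum_sub_distrib] at h2
      linarith
    _ = ∑ i, |c i| * y ((g.symm.trans h) i) := by
      rw [← Equiv.sum_comp g]; simp

/-- A seminorm on `m → ℝ` invariant under permutations and sign changes is monotone with respect
to weak majorization. -/
theorem Seminorm.le_of_excess [DecidableEq m] (q : Seminorm ℝ (m → ℝ))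
    (hperm : ∀ (σ : Equiv.Perm m) v, q (v ∘ σ) = q v)
    (hsign : ∀ (s : m → ℝ) v, (∀ i, |s i| = 1) → q (s * v) = q v)
    {x y : m → ℝ} (hx0 : ∀ i, 0 ≤ x i) (hy0 : ∀ i, 0 ≤ y i)
    (hxy : ∀ t, 0 < t → ∑ i, max (x i - t) 0 ≤ ∑ i, max (y i - t) 0) : q x ≤ q y := by
  -- Hahn–Banach: a functional dominated by `q` that attains `q x` at `x`. It reduces the claim to
  -- weighted sums, with the coefficients of `φ` as weights.
  obtain ⟨φ, hφx, hφ⟩ : ∃ φ : (m → ℝ) →ₗ[ℝ] ℝ, φ x = q x ∧ ∀ v, φ v ≤ q v := by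
    by_cases hx : x = 0
    · exact ⟨0, by simp [hx], fun v => by simp⟩
    let f : (m → ℝ) →ₗ.[ℝ] ℝ := LinearPMap.mkSpanSingleton x (q x) hx
    obtain ⟨φ, h1, h2⟩ := exists_extension_of_le_sublinear f q
      (fun c hc v => by rw [map_smul_eq_mul, Real.norm_of_nonneg hc.le]) (fun v w => map_add_le_add q v w)
      (by
        rintro ⟨v, hv⟩
        obtain ⟨r, rfl⟩ := Submodule.mem_span_singleton.1 hv
        rw [LinearPMap.mkSpanSingleton'_apply, map_smul_eq_mul, smul_eq_mul]
        exact mul_le_mul_of_nonneg_right (le_abs_self r) (apply_nonneg q x))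
    refine ⟨φ, ?_, h2⟩
    have := h1 ⟨x, Submodule.mem_span_singleton_self x⟩
    rw [this]
    exact LinearPMap.mkSpanSingleton_apply ..
  have hφs : ∀ v, φ v = ∑ i, φ (Pi.single i 1) * v i := fun v => by
    conv_lhs => rw [← Finset.univ_sum_single v, map_sum]
    refine Finset.sum_congr rfl fun i _ => ?_
    rw [show (Pi.single i (v i) : m → ℝ) = v i • Pi.single i 1 by
      rw [← Pi.single_smul, smul_eq_mul, mul_one], map_smul, smul_eq_mul, mul_comm]
  obtain ⟨σ, hσ⟩ := exists_perm_sum_mul_le hx0 hy0 hxy fun i => φ (Pi.single i 1)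
  -- The signs of the coefficients of `φ`: the bound with |coefficients| is then the value of `φ` at
  -- a signed permutation of `y`.
  let s : m → ℝ := fun i => if 0 ≤ φ (Pi.single i 1) then 1 else -1
  have hs : ∀ i, |s i| = 1 := fun i => by simp only [s]; split_ifs <;> simp
  calc q x = φ x := hφx.symm
    _ ≤ ∑ i, |φ (Pi.single i 1)| * y (σ i) := by rw [hφs x]; exact hσ
    _ = φ (s * (y ∘ σ)) := by
      rw [hφs]
      refine Finset.sum_congr rfl fun i _ => ?_
      simp only [s, Pi.mul_apply, Function.comp]
      split_ifs with h
      · rw [abs_of_nonneg h]; ring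
      · rw [abs_of_neg (not_le.1 h)]; ring
    _ ≤ q (s * (y ∘ σ)) := hφ _
    _ = q y := by rw [hsign s _ hs, hperm]

end Majorization

/-! ### Orthogonally invariant seminorms: Fan dominance and the ideal property. -/

section OrthogonallyInvariant

variable {m : Type*} [Fintype m] [DecidableEq m]

/-- Invariance of a seminorm on real matrices under orthogonal matrices. -/
def IsOrthogonallyInvariant (p : Seminorm ℝ (Matrix m m ℝ)) : Prop :=
  ∀ U ∈ Matrix.unitaryGroup m ℝ, ∀ V ∈ Matrix.unitaryGroup m ℝ, ∀ X, p (U * X * V) = p X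

namespace IsOrthogonallyInvariant

variable {p : Seminorm ℝ (Matrix m m ℝ)}

theorem mul_left (hp : IsOrthogonallyInvariant p) {U : Matrix m m ℝ}
    (hU : U ∈ Matrix.unitaryGroup m ℝ) (X : Matrix m m ℝ) : p (U * X) = p X := by
  simpa using hp U hU 1 (one_mem _) X

theorem mul_right (hp : IsOrthogonallyInvariant p) {V : Matrix m m ℝ}
    (hV : V ∈ Matrix.unitaryGroup m ℝ) (X : Matrix m m ℝ) : p (X * V) = p X := by
  simpa using hp 1 (one_mem _) V hV X

theorem diagConj_eq (hp : IsOrthogonallyInvariant p) {U : Matrix m m ℝ}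
    (hU : U ∈ Matrix.unitaryGroup m ℝ) (a : m → ℝ) : p (diagConj U a) = p (Matrix.diagonal a) := by
  rw [diagConj, hp U hU (star U) (Matrix.star_mem_unitaryGroup hU)]; rfl

theorem comp_transpose (hp : IsOrthogonallyInvariant p) :
    IsOrthogonallyInvariant (p.comp (Matrix.transposeLinearEquiv m m ℝ ℝ).toLinearMap) := by
  intro U hU V hV X
  have ht : ∀ {U : Matrix m m ℝ}, U ∈ Matrix.unitaryGroup m ℝ → Uᵀ ∈ Matrix.unitaryGroup m ℝ := by
    intro U hU
    have := Matrix.star_mem_unitaryGroup hU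
    rwa [Matrix.star_eq_conjTranspose, Matrix.conjTranspose_eq_transpose_of_trivial] at this
  change p (U * X * V)ᵀ = p Xᵀ
  rw [Matrix.transpose_mul, Matrix.transpose_mul, ← mul_assoc]
  exact hp _ (ht hV) _ (ht hU) _

theorem diagonal_sign_mem {s : m → ℝ} (hs : ∀ i, |s i| = 1) :
    Matrix.diagonal s ∈ Matrix.unitaryGroup m ℝ := by
  rw [Matrix.mem_unitaryGroup_iff, Matrix.star_eq_conjTranspose, Matrix.diagonal_conjTranspose,
    Matrix.diagonal_mul_diagonal, ← Matrix.diagonal_one]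
  congr 1
  ext i
  have := abs_mul_abs_self (s i)
  rw [hs i] at this
  simpa using this.symm

/-- Fan dominance for diagonal matrices. -/
theorem diagonal_le_of_excess (hp : IsOrthogonallyInvariant p) {x y : m → ℝ}
    (hxy : ∀ t, 0 < t → ∑ i, max (|x i| - t) 0 ≤ ∑ i, max (|y i| - t) 0) :
    p (Matrix.diagonal x) ≤ p (Matrix.diagonal y) := by
  let q : Seminorm ℝ (m → ℝ) := p.comp (Matrix.diagonalLinearMap m ℝ ℝ)
  have hq : ∀ v, q v = p (Matrix.diagonal v) := fun _ => rfl
  have hsign : ∀ (s : m → ℝ) v, (∀ i, |s i| = 1) → q (s * v) = q v := fun s v hs => by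
    rw [hq, hq, ← hp.mul_left (diagonal_sign_mem hs) (Matrix.diagonal v),
      Matrix.diagonal_mul_diagonal]; rfl
  have habs : ∀ v : m → ℝ, q (fun i => |v i|) = q v := fun v => by
    have := hsign (fun i => if 0 ≤ v i then 1 else -1) v (fun i => by split_ifs <;> simp)
    rw [← this]
    congr 1
    ext i
    simp only [Pi.mul_apply]
    split_ifs with h
    · rw [abs_of_nonneg h, one_mul]
    · rw [abs_of_neg (not_le.1 h)]; ring
  rw [← hq, ← hq, ← habs x, ← habs y]
  refine q.le_of_excess (fun σ v => ?_) hsign (fun _ => abs_nonneg _) (fun _ => abs_nonneg _) hxy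
  rw [hq, ← hp.diagConj_eq (Matrix.unitaryGroup_submatrix (one_mem _) σ), diagConj_submatrix,
        hp.diagConj_eq (one_mem _), hq]

/-- The left side is convex in `s`, so over the cube [-c, c]^m it is dominated by its value at a
vertex. A vertex is `c` times a sign vector, whose diagonal matrix is orthogonal. -/
theorem diagonal_mul_le (hp : IsOrthogonallyInvariant p) {s : m → ℝ} {c : ℝ}
    (hs : ∀ i, |s i| ≤ c) (Y : Matrix m m ℝ) : p (Matrix.diagonal s * Y) ≤ c * p Y := by
  let F : (m → ℝ) →ₗ[ℝ] Matrix m m ℝ :=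
    (LinearMap.mulRight ℝ Y) ∘ₗ (Matrix.diagonalLinearMap m ℝ ℝ)
  have hF : ∀ v, F v = Matrix.diagonal v * Y := fun _ => rfl
  have hconv : ConvexOn ℝ Set.univ fun v => p (F v) := (p.comp F).convexOn
  have hmem : s ∈ convexHull ℝ (Set.univ.pi fun _ : m => ({-c, c} : Set ℝ)) := by
    rw [convexHull_pi]
    intro i _
    have := abs_le.1 (hs i)
    rw [convexHull_pair, segment_eq_Icc (by linarith)]
    exact this
  obtain ⟨v, hv, hle⟩ := hconv.exists_ge_of_mem_convexHull (Set.subset_univ _) hmem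
  refine hle.trans ?_
  have hv' : ∀ i, v i = c ∨ v i = -c := fun i => (hv i trivial).symm
  -- Without indices the hypothesis does not force c ≥ 0, but then every value of `p` is 0.
  by_cases hm : IsEmpty m
  · have : ∀ Z : Matrix m m ℝ, p Z = 0 := fun Z => by
      rw [Subsingleton.elim Z 0, map_zero]
    simp [this]
  have hc : 0 ≤ c := by
    obtain ⟨i⟩ := not_isEmpty_iff.1 hm
    exact (abs_nonneg _).trans (hs i)
  let e : m → ℝ := fun i => if v i = c then 1 else -1
  have he : ∀ i, |e i| = 1 := fun i => by simp only [e]; split_ifs <;> simp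
  have hve : v = c • e := by
    ext i
    simp only [e, Pi.smul_apply, smul_eq_mul]
    split_ifs with h
    · rw [h, mul_one]
    · rw [(hv' i).resolve_left h]; ring
  rw [hve, map_smul, map_smul_eq_mul, Real.norm_of_nonneg hc, hF, hp.mul_left (diagonal_sign_mem he)]

theorem hermitian_mul_le (hp : IsOrthogonallyInvariant p) {S : Matrix m m ℝ}
    (hS : S.IsHermitian) (Y : Matrix m m ℝ) : p (S * Y) ≤ ‖S‖ * p Y := by
  obtain ⟨U, hU, a, rfl⟩ := hS.exists_diagConj
  have h1 : ‖diagConj U a‖ = ‖a‖ := by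
    have := CStarRing.norm_mem_unitary_mul (Matrix.diagonal a * star U) hU
    rw [diagConj, mul_assoc]
    exact this.trans ((CStarRing.norm_mul_mem_unitary (Matrix.diagonal a) (Matrix.star_mem_unitaryGroup hU)).trans
      (Matrix.l2_opNorm_diagonal a))
  rw [h1, diagConj, mul_assoc, mul_assoc, hp.mul_left hU, ← hp.mul_left (Matrix.star_mem_unitaryGroup hU) Y]
  exact hp.diagonal_mul_le (fun i => norm_le_pi_norm a i) _

theorem mul_hermitian_le (hp : IsOrthogonallyInvariant p) {S : Matrix m m ℝ}
    (hS : S.IsHermitian) (Y : Matrix m m ℝ) : p (Y * S) ≤ ‖S‖ * p Y := by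
  have := hp.comp_transpose.hermitian_mul_le hS Yᵀ
  have hS' : Sᵀ = S := by rw [← Matrix.conjTranspose_eq_transpose_of_trivial]; exact hS
  simpa [hS'] using this

end IsOrthogonallyInvariant

end OrthogonallyInvariant

/-! ### Comparing √A - √B with |A - B|^{1/2}. -/

section SquareRoot

variable {m : Type*} [Fintype m] [DecidableEq m]

/-- By cyclicity tr(XY) = tr(√X Y √X), the trace of a positive semidefinite matrix. -/
theorem Matrix.PosSemidef.trace_mul_nonneg {X Y : Matrix m m ℝ} (hX : X.PosSemidef)
    (hY : Y.PosSemidef) : 0 ≤ (X * Y).trace := by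
  have hs := Matrix.nonneg_iff_posSemidef.1 (CFC.sqrt_nonneg X)
  have h : X * Y = CFC.sqrt X * (CFC.sqrt X * Y) := by
    rw [← mul_assoc, CFC.sqrt_mul_sqrt_self X hX.nonneg]
  rw [h, Matrix.trace_mul_comm]
  have := (hY.mul_mul_conjTranspose_same (CFC.sqrt X)).trace_nonneg
  rwa [hs.isHermitian.eq] at this

/-- Operator monotonicity of the square root. -/
theorem Matrix.le_of_mul_self_le {P Q : Matrix m m ℝ} (hP : P.PosSemidef) (hQ : Q.PosDef)
    (h : P * P ≤ Q * Q) : P ≤ Q := by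
  have hX : (Q - P).IsHermitian := hQ.isHermitian.sub hP.isHermitian
  have hW : (Q + P).PosDef := hQ.add_posSemidef hP
  rw [Matrix.le_iff, hX.posSemidef_iff_eigenvalues_nonneg]
  intro i
  set v : m → ℝ := ⇑(hX.eigenvectorBasis i) with hv
  set l := hX.eigenvalues i
  have hXv : (Q - P) *ᵥ v = l • v := hX.mulVec_eigenvectorBasis i
  have hv0 : v ≠ 0 := fun h0 => by
    have h1 := hX.eigenvectorBasis.orthonormal.ne_zero i
    exact h1 (by ext j; exact congrFun h0 j)
  have h1 := (Matrix.le_iff.1 h).dotProduct_mulVec_nonneg v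
  have hWv := hW.dotProduct_mulVec_pos hv0
  -- At an eigenvector of Q - P with eigenvalue `l`, this identity makes the form of Q² - P² equal
  -- to `l` times that of Q + P, which is positive; hence l ≥ 0.
  have key : (2 : ℝ) • (Q * Q - P * P) = (Q - P) * (Q + P) + (Q + P) * (Q - P) := by
    rw [two_smul]; noncomm_ring
  have hXt : v ᵥ* (Q - P) = l • v := by
    rw [← Matrix.mulVec_transpose, ← Matrix.conjTranspose_eq_transpose_of_trivial, hX.eq, hXv]
  have h2 : 2 * (v ⬝ᵥ ((Q * Q - P * P) *ᵥ v)) = 2 * (l * (v ⬝ᵥ ((Q + P) *ᵥ v))) := by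
    rw [← smul_eq_mul, ← dotProduct_smul, ← Matrix.smul_mulVec, key, Matrix.add_mulVec,
      dotProduct_add, ← Matrix.mulVec_mulVec, ← Matrix.mulVec_mulVec, hXv,
      Matrix.dotProduct_mulVec, hXt, Matrix.mulVec_smul, dotProduct_smul, smul_dotProduct]
    simp only [smul_eq_mul]; ring
  rw [star_trivial] at h1 hWv
  by_contra! hl
  have := mul_neg_of_neg_of_pos hl hWv
  linarith

theorem Matrix.PosDef.sqrt_posDef {A : Matrix m m ℝ} (hA : A.PosDef) : (CFC.sqrt A).PosDef := by
  have h := Matrix.nonneg_iff_posSemidef.1 (CFC.sqrt_nonneg A)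
  rw [h.posDef_iff_isUnit]
  have h2 : IsUnit (CFC.sqrt A * CFC.sqrt A) := by
    rw [CFC.sqrt_mul_sqrt_self A hA.posSemidef.nonneg]; exact hA.isUnit
  rw [Matrix.isUnit_iff_isUnit_det, Matrix.det_mul] at h2
  rw [Matrix.isUnit_iff_isUnit_det]
  exact isUnit_of_mul_isUnit_left h2

/-- Inversion is decreasing on positive definite matrices. -/
theorem Matrix.PosDef.inv_sub_inv_posSemidef {V W : Matrix m m ℝ} (hV : V.PosDef) (hW : W.PosDef)
    (h : V ≤ W) : (V⁻¹ - W⁻¹).PosSemidef := by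
  have e : V⁻¹ - W⁻¹ = (V⁻¹ - W⁻¹) * V * (V⁻¹ - W⁻¹)ᴴ + W⁻¹ * (W - V) * (W⁻¹)ᴴ := by
    rw [(hV.inv.isHermitian.sub hW.inv.isHermitian).eq, hW.inv.isHermitian.eq]
    have h1 : V * V⁻¹ = 1 := V.mul_nonsing_inv ((Matrix.isUnit_iff_isUnit_det V).1 hV.isUnit)
    have h2 : V⁻¹ * V = 1 := V.nonsing_inv_mul ((Matrix.isUnit_iff_isUnit_det V).1 hV.isUnit)
    have h3 : W⁻¹ * W = 1 := W.nonsing_inv_mul ((Matrix.isUnit_iff_isUnit_det W).1 hW.isUnit)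
    have : (V⁻¹ - W⁻¹) * V * (V⁻¹ - W⁻¹) + W⁻¹ * (W - V) * W⁻¹ =
      (V⁻¹ * V) * V⁻¹ - (V⁻¹ * V) * W⁻¹ - W⁻¹ * (V * V⁻¹) + (W⁻¹ * W) * W⁻¹ := by noncomm_ring
    rw [this, h1, h2, h3]
    simp
  rw [e]
  exact (hV.posSemidef.mul_mul_conjTranspose_same _).add
    ((Matrix.le_iff.1 h).mul_mul_conjTranspose_same _)

/-- Multiplying the Lyapunov equation by W⁻¹ and taking traces gives tr E = tr(W⁻¹Z), while tr G =
tr(V⁻¹Z). The comparison is then W⁻¹ ≤ V⁻¹ tested against Z ≥ 0. -/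
theorem trace_le_of_mul_add_mul {E W V Z G : Matrix m m ℝ} (hV : V.PosDef) (hVW : V ≤ W)
    (hZ : Z.PosSemidef) (hE : W * E + E * W = Z + Z) (hG : V * G = Z) : E.trace ≤ G.trace := by
  have hW : W.PosDef := by
    have := hV.add_posSemidef (Matrix.le_iff.1 hVW)
    rwa [add_sub_cancel] at this
  have h1 : W⁻¹ * W = 1 := W.nonsing_inv_mul ((Matrix.isUnit_iff_isUnit_det W).1 hW.isUnit)
  have h1' : W * W⁻¹ = 1 := W.mul_nonsing_inv ((Matrix.isUnit_iff_isUnit_det W).1 hW.isUnit)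
  have h2 : V⁻¹ * V = 1 := V.nonsing_inv_mul ((Matrix.isUnit_iff_isUnit_det V).1 hV.isUnit)
  have h3 := (hV.inv_sub_inv_posSemidef hW hVW).trace_mul_nonneg hZ
  have h4 : (W⁻¹ * Z).trace = E.trace := by
    have h5 : (W⁻¹ * (W * E + E * W)).trace = E.trace + E.trace := by
      rw [mul_add, ← mul_assoc, h1, one_mul, Matrix.trace_add, Matrix.trace_mul_comm, mul_assoc,
        h1', mul_one]
    rw [hE, mul_add, Matrix.trace_add] at h5
    linarith
  have h6 : V⁻¹ * Z = G := by rw [← hG, ← mul_assoc, h2, one_mul]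
  rw [sub_mul, Matrix.trace_sub, h4, h6] at h3
  linarith

/-- If `X ≤ E + t` with `E ≥ 0`, the excess of the eigenvalues of `X` over `t` is at most
`tr E`. -/
theorem sum_excess_le_trace {U E : Matrix m m ℝ} (hU : U ∈ Matrix.unitaryGroup m ℝ) {x : m → ℝ}
    {t : ℝ} (hE : E.PosSemidef) (h : diagConj U x ≤ E + t • 1) :
    ∑ i, max (x i - t) 0 ≤ E.trace := by
  have htr : (star U * E * U).trace = E.trace := by
    rw [Matrix.trace_mul_comm, ← mul_assoc, Matrix.unitaryGroup_mul_star_self hU, one_mul]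
  rw [← htr]
  -- In the eigenbasis `U`, each diagonal entry of `E` dominates both `x i - t` and 0.
  refine Finset.sum_le_sum fun i _ => max_le ?_ ?_
  · have h0 := diagConj_const (𝕜 := ℝ) hU t
    rw [RCLike.ofReal_real_eq_id, id] at h0
    have h1 : diagConj U (x - fun _ => t) ≤ E := by
      rw [diagConj_sub, h0]; exact sub_le_iff_le_add.2 h
    have h2 := ((Matrix.le_iff.1 h1).conjTranspose_mul_mul_same U).diag_nonneg (i := i)
    have h3 : star U * diagConj U (x - fun _ => t) * U = Matrix.diagonal (x - fun _ => t) := by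
      have hs := Matrix.unitaryGroup_star_mul_self hU
      rw [diagConj, mul_assoc, mul_assoc _ (star U) U, hs, mul_one, ← mul_assoc, hs, one_mul]
      rfl
    rw [← Matrix.star_eq_conjTranspose, mul_sub, sub_mul, h3, Matrix.sub_apply,
      Matrix.diagonal_apply_eq, sub_nonneg] at h2
    exact h2
  · exact (hE.conjTranspose_mul_mul_same U).diag_nonneg

/-- One-sided majorization: `√` vanishes on negative reals, so only the positive eigenvalues of A -
B count on the right. With P = √(B + R²) and Q = √(B + t²), operator monotonicity gives √A - √B ≤ (P
- Q) + t, which leaves tr(P - Q) ≤ tr(R - t) to be shown. -/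
theorem sum_excess_sqrt_sub_le {A B U V : Matrix m m ℝ} (hA : A.PosDef) (hB : B.PosDef)
    (hU : U ∈ Matrix.unitaryGroup m ℝ) (hV : V ∈ Matrix.unitaryGroup m ℝ) {x h : m → ℝ}
    (hx : CFC.sqrt A - CFC.sqrt B = diagConj V x) (hh : A - B = diagConj U h) {t : ℝ}
    (ht : 0 < t) :
    ∑ i, max (x i - t) 0 ≤ ∑ i, max (√(h i) - t) 0 := by
  have hconst : ∀ s : ℝ, diagConj U (fun _ => s) = s • 1 := fun s => by
    have h0 := diagConj_const (𝕜 := ℝ) hU s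
    rwa [RCLike.ofReal_real_eq_id, id] at h0
  have htt : ((t * t) • (1 : Matrix m m ℝ)).PosDef := Matrix.PosDef.one.smul (by positivity)
  have ht1 : (t • (1 : Matrix m m ℝ)).PosDef := Matrix.PosDef.one.smul ht
  -- Chosen so that R² ≥ A - B and R² ≥ t², while tr(R - t) is exactly the desired right-hand side.
  set r : m → ℝ := fun i => max (√(h i)) t with hr
  have hr0 : ∀ i, t ≤ r i := fun i => le_max_right _ _
  set R := diagConj U r with hR
  have hRR : R * R = diagConj U (r * r) := diagConj_mul hU r r
  have hR0 : R.PosSemidef := diagConj_posSemidef U fun i => ht.le.trans (hr0 i)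
  have hRt : (t * t) • (1 : Matrix m m ℝ) ≤ R * R := by
    rw [hRR, ← hconst]
    exact diagConj_mono U fun i => mul_self_le_mul_self ht.le (hr0 i)
  have hHR : A - B ≤ R * R := by
    rw [hRR, hh]
    refine diagConj_mono U fun i => ?_
    rcases le_total 0 (h i) with h0 | h0
    · calc h i = √(h i) * √(h i) := (Real.mul_self_sqrt h0).symm
        _ ≤ r i * r i := mul_self_le_mul_self (Real.sqrt_nonneg _) (le_max_left _ _)
    · exact h0.trans (mul_self_nonneg _)
  have hC : (R * R).PosSemidef := Matrix.nonneg_iff_posSemidef.1 (htt.posSemidef.nonneg.trans hRt)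
  have hBC : (B + R * R).PosDef := hB.add_posSemidef hC
  have hBt : (B + (t * t) • (1 : Matrix m m ℝ)).PosDef := hB.add htt
  set P := CFC.sqrt (B + R * R) with hP
  set Q := CFC.sqrt (B + (t * t) • (1 : Matrix m m ℝ)) with hQ
  have hPP : P * P = B + R * R := CFC.sqrt_mul_sqrt_self _ hBC.posSemidef.nonneg
  have hQQ : Q * Q = B + (t * t) • (1 : Matrix m m ℝ) :=
    CFC.sqrt_mul_sqrt_self _ hBt.posSemidef.nonneg
  have hAA : CFC.sqrt A * CFC.sqrt A = A := CFC.sqrt_mul_sqrt_self _ hA.posSemidef.nonneg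
  have hBB : CFC.sqrt B * CFC.sqrt B = B := CFC.sqrt_mul_sqrt_self _ hB.posSemidef.nonneg
  have hPd : P.PosDef := hBC.sqrt_posDef
  have hQd : Q.PosDef := hBt.sqrt_posDef
  have hAP : CFC.sqrt A ≤ P := Matrix.le_of_mul_self_le hA.sqrt_posDef.posSemidef hPd (by
    rw [hAA, hPP]; exact sub_le_iff_le_add'.1 hHR)
  have hQB : Q ≤ CFC.sqrt B + t • 1 := Matrix.le_of_mul_self_le hQd.posSemidef
    (hB.sqrt_posDef.add ht1) (by
      have : (CFC.sqrt B + t • 1) * (CFC.sqrt B + t • 1) =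
          CFC.sqrt B * CFC.sqrt B + (t * t) • 1 + (2 * t) • CFC.sqrt B := by
        simp only [mul_add, add_mul, smul_mul_assoc, mul_smul_comm, one_mul, mul_one]
        module
      rw [this, hBB, hQQ, le_add_iff_nonneg_right]
      exact (hB.sqrt_posDef.posSemidef.smul (by positivity : 0 ≤ 2 * t)).nonneg)
  have hRP : R ≤ P := Matrix.le_of_mul_self_le hR0 hPd (by
    rw [hPP, le_add_iff_nonneg_left]; exact hB.posSemidef.nonneg)
  have htQ : t • 1 ≤ Q := Matrix.le_of_mul_self_le ht1.posSemidef hQd (by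
    rw [hQQ, smul_mul_smul_comm, one_mul, le_add_iff_nonneg_left]; exact hB.posSemidef.nonneg)
  have hQP : Q ≤ P := Matrix.le_of_mul_self_le hQd.posSemidef hPd (by
    rw [hQQ, hPP]; exact add_le_add_right hRt _)
  have hXE : diagConj V x ≤ (P - Q) + t • 1 := by
    rw [← hx]
    calc CFC.sqrt A - CFC.sqrt B ≤ P - (Q - t • 1) :=
          sub_le_sub hAP (sub_le_iff_le_add.2 hQB)
      _ = (P - Q) + t • 1 := by abel
  refine (sum_excess_le_trace hV (Matrix.le_iff.1 hQP) hXE).trans ?_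
  have hG : (R - t • 1).trace = ∑ i, max (√(h i) - t) 0 := by
    rw [hR, ← hconst, ← diagConj_sub, diagConj_trace hU]
    refine Finset.sum_congr rfl fun i _ => ?_
    simp only [Pi.sub_apply, hr]
    rw [← max_sub_sub_right, sub_self]
  rw [← hG]
  -- P - Q solves a Lyapunov equation with coefficient P + Q and right side 2(P² - Q²) = 2(R² - t²);
  -- R - t is its counterpart for the smaller coefficient R + t.
  refine trace_le_of_mul_add_mul (W := P + Q) (V := R + t • 1) (Z := R * R - (t * t) • 1)
    (ht1.posSemidef_add hR0) (add_le_add hRP htQ) (Matrix.le_iff.1 hRt) ?_ ?_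
  · have : (P + Q) * (P - Q) + (P - Q) * (P + Q) = (P * P - Q * Q) + (P * P - Q * Q) := by
      noncomm_ring
    rw [this, hPP, hQQ, add_sub_add_left_eq_sub]
  · simp only [mul_sub, add_mul, smul_mul_assoc, mul_smul_comm, one_mul, mul_one]
    module

theorem diagConj_sqrt_abs {U : Matrix m m ℝ} (hU : U ∈ Matrix.unitaryGroup m ℝ) (h : m → ℝ) :
    CFC.sqrt (CFC.abs (diagConj U h)) = diagConj U fun i => √|h i| := by
  have h1 : CFC.abs (diagConj U h) = diagConj U fun i => |h i| := by
    refine CFC.sqrt_unique ?_ (diagConj_posSemidef U fun i => abs_nonneg _).nonneg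
    rw [Matrix.star_eq_conjTranspose, (diagConj_isHermitian U h).eq, diagConj_mul hU,
      diagConj_mul hU]
    congr 1; ext i; simp
  rw [h1]
  refine CFC.sqrt_unique ?_ (diagConj_posSemidef U fun i => Real.sqrt_nonneg _).nonneg
  rw [diagConj_mul hU]
  congr 1; ext i; simp

/-- This splitting, with its analogue for square roots, reduces a bound on absolute values to
one-sided bounds for (A, B) and for (B, A). -/
theorem max_abs_sub_eq {x t : ℝ} (ht : 0 < t) :
    max (|x| - t) 0 = max (x - t) 0 + max (-x - t) 0 := by
  rcases le_total 0 x with h | h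
  · rw [abs_of_nonneg h, max_eq_right (a := -x - t) (by linarith), add_zero]
  · rw [abs_of_nonpos h, max_eq_right (a := x - t) (by linarith), zero_add]

theorem max_sqrt_abs_sub_eq {x t : ℝ} (ht : 0 < t) :
    max (√|x| - t) 0 = max (√x - t) 0 + max (√(-x) - t) 0 := by
  rcases le_total 0 x with h | h
  · rw [abs_of_nonneg h, Real.sqrt_eq_zero_of_nonpos (neg_nonpos.2 h),
      max_eq_right (a := 0 - t) (by linarith), add_zero]
  · rw [abs_of_nonpos h, Real.sqrt_eq_zero_of_nonpos h,
      max_eq_right (a := 0 - t) (by linarith), zero_add]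

/-- `|||√A - √B||| ≤ ||| |A - B|^{1/2} |||` for orthogonally invariant seminorms. -/
theorem IsOrthogonallyInvariant.sqrt_sub_sqrt_le {p : Seminorm ℝ (Matrix m m ℝ)}
    (hp : IsOrthogonallyInvariant p) {A B : Matrix m m ℝ} (hA : A.PosDef) (hB : B.PosDef) :
    p (CFC.sqrt A - CFC.sqrt B) ≤ p (CFC.sqrt (CFC.abs (A - B))) := by
  obtain ⟨U, hU, h, hh⟩ := (hA.isHermitian.sub hB.isHermitian).exists_diagConj
  obtain ⟨V, hV, x, hx⟩ :=
    (hA.sqrt_posDef.isHermitian.sub hB.sqrt_posDef.isHermitian).exists_diagConj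
  rw [hx, hh, diagConj_sqrt_abs hU, hp.diagConj_eq hU, hp.diagConj_eq hV]
  refine hp.diagonal_le_of_excess fun t ht => ?_
  simp only [abs_of_nonneg (Real.sqrt_nonneg _), max_abs_sub_eq ht, max_sqrt_abs_sub_eq ht,
    Finset.sum_add_distrib]
  refine add_le_add (sum_excess_sqrt_sub_le hA hB hU hV hx hh ht) ?_
  exact sum_excess_sqrt_sub_le hB hA hU hV (x := -x) (h := -h)
    (by rw [diagConj_neg, ← hx, neg_sub]) (by rw [diagConj_neg, ← hh, neg_sub]) ht

end SquareRoot

/-! ### Orthogonal normal form of skew-symmetric matrices. -/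

section SkewNormalForm

open scoped InnerProductSpace

/-- A nonzero skew-symmetric operator rotates some orthonormal pair, up to a scalar. -/
theorem exists_skew_pair {E : Type*} [NormedAddCommGroup E] [InnerProductSpace ℝ E]
    [FiniteDimensional ℝ E] (T : E →ₗ[ℝ] E) (hT : ∀ x y, ⟪T x, y⟫_ℝ = -⟪x, T y⟫_ℝ) (h0 : T ≠ 0) :
    ∃ (v w : E) (d : ℝ), 0 ≤ d ∧ ‖v‖ = 1 ∧ ‖w‖ = 1 ∧ ⟪v, w⟫_ℝ = 0 ∧ T v = d • w ∧ T w = -(d • v) := by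
  -- T² is symmetric with T² = -TᵀT. For an eigenvector `v` of T² with T v ≠ 0, the vector T v is
  -- orthogonal to `v` by skewness, and the plane of `v` and T v is invariant with d = ‖T v‖.
  have hsym : (T ∘ₗ T).IsSymmetric := fun x y => by
    simp only [LinearMap.comp_apply, hT, neg_neg]
  obtain ⟨i, hi⟩ : ∃ i, T (hsym.eigenvectorBasis rfl i) ≠ 0 := by
    by_contra! h
    exact h0 ((hsym.eigenvectorBasis rfl).toBasis.ext fun i => by simpa using h i)
  set v := hsym.eigenvectorBasis rfl i with hv
  have hv1 : ‖v‖ = 1 := (hsym.eigenvectorBasis rfl).orthonormal.1 i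
  have hTT : T (T v) = hsym.eigenvalues rfl i • v := hsym.apply_eigenvectorBasis rfl i
  set l := hsym.eigenvalues rfl i
  have hd : 0 < ‖T v‖ := norm_pos_iff.2 hi
  have hl : l = -‖T v‖ ^ 2 := by
    rw [← real_inner_self_eq_norm_sq, hT, neg_neg, hTT, inner_smul_right,
      real_inner_self_eq_norm_sq, hv1]
    simp
  have hvT : ⟪v, T v⟫_ℝ = 0 := by
    have := hT v v
    rw [real_inner_comm] at this
    linarith
  refine ⟨v, ‖T v‖⁻¹ • T v, ‖T v‖, hd.le, hv1, ?_, ?_, ?_, ?_⟩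
  · rw [norm_smul, norm_inv, norm_norm, inv_mul_cancel₀ hd.ne']
  · rw [inner_smul_right, hvT, mul_zero]
  · rw [smul_smul, mul_inv_cancel₀ hd.ne', one_smul]
  · rw [map_smul, hTT, hl, smul_smul, ← neg_smul]
    congr 1
    field_simp

/-- The orthogonal normal form of a skew-symmetric operator on an even-dimensional space. -/
theorem exists_skew_basis (n : ℕ) : ∀ {E : Type*} [NormedAddCommGroup E] [InnerProductSpace ℝ E]
    [FiniteDimensional ℝ E] (T : E →ₗ[ℝ] E) (_ : ∀ x y, ⟪T x, y⟫_ℝ = -⟪x, T y⟫_ℝ)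
    (_ : Module.finrank ℝ E = n + n),
    ∃ (b : Fin n ⊕ Fin n → E) (d : Fin n → ℝ), Orthonormal ℝ b ∧ (∀ j, 0 ≤ d j) ∧
      (∀ j, T (b (Sum.inl j)) = d j • b (Sum.inr j)) ∧
      ∀ j, T (b (Sum.inr j)) = -(d j • b (Sum.inl j)) := by
  induction n with
  | zero =>
    intro E _ _ _ T _ _
    exact ⟨fun i => isEmptyElim i, 0, ⟨fun i => isEmptyElim i, fun i => isEmptyElim i⟩,
      fun i => i.elim0, fun i => i.elim0, fun i => i.elim0⟩
  | succ n ih =>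
    intro E _ _ _ T hT hE
    by_cases h0 : T = 0
    · let e : Fin (Module.finrank ℝ E) ≃ Fin (n + 1) ⊕ Fin (n + 1) :=
        (finCongr hE).trans finSumFinEquiv.symm
      let b := (stdOrthonormalBasis ℝ E).reindex e
      exact ⟨b, 0, b.orthonormal, fun _ => le_rfl, fun j => by simp [h0], fun j => by simp [h0]⟩
    obtain ⟨v, w, d, hd, hv, hw, hvw, hTv, hTw⟩ := exists_skew_pair T hT h0
    have hwv : ⟪w, v⟫_ℝ = 0 := by rw [real_inner_comm]; exact hvw
    -- Skewness makes the complement of the invariant plane invariant, so the induction continues in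
    -- dimension 2n.
    let F : Submodule ℝ E := (Submodule.span ℝ (Set.range ![v, w]))ᗮ
    have hF : ∀ x, x ∈ F ↔ ⟪v, x⟫_ℝ = 0 ∧ ⟪w, x⟫_ℝ = 0 := fun x => by
      simp only [F, Submodule.mem_orthogonal]
      refine ⟨fun h => ⟨h v (Submodule.subset_span ⟨0, rfl⟩), h w (Submodule.subset_span ⟨1, rfl⟩)⟩,
        fun h u hu => ?_⟩
      induction hu using Submodule.span_induction with
      | mem u hu =>
        obtain ⟨i, rfl⟩ := hu
        fin_cases i
        exacts [h.1, h.2]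
      | zero => simp
      | add a b _ _ ha hb => rw [inner_add_left, ha, hb, add_zero]
      | smul c a _ ha => rw [inner_smul_left, ha, mul_zero]
    have hTF : ∀ x ∈ F, T x ∈ F := fun x hx => by
      rw [hF] at hx ⊢
      have h1 := hT v x
      have h2 := hT w x
      rw [hTv, inner_smul_left, hx.2, mul_zero] at h1
      rw [hTw, inner_neg_left, inner_smul_left, hx.1, mul_zero] at h2
      exact ⟨by linarith, by linarith⟩
    have hvw' : Orthonormal ℝ ![v, w] := by
      rw [orthonormal_iff_ite]
      intro i j
      fin_cases i <;> fin_cases j <;> simp [hv, hw, hvw, hwv]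
    have hfr : Module.finrank ℝ F = n + n := by
      have h1 := (Submodule.span ℝ (Set.range ![v, w])).finrank_add_finrank_orthogonal
      rw [finrank_span_eq_card hvw'.linearIndependent, hE, Fintype.card_fin] at h1
      change Module.finrank ℝ (Submodule.span ℝ (Set.range ![v, w]))ᗮ = n + n
      omega
    obtain ⟨b, d', hb, hd', h1, h2⟩ := ih (T.restrict hTF) (fun x y => hT x y) hfr
    rw [orthonormal_iff_ite] at hb
    have hbi : ∀ i j, ⟪(b i : E), (b j : E)⟫_ℝ = if i = j then 1 else 0 := hb
    have hvb : ∀ i, ⟪v, (b i : E)⟫_ℝ = 0 := fun i => ((hF _).1 (b i).2).1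
    have hwb : ∀ i, ⟪w, (b i : E)⟫_ℝ = 0 := fun i => ((hF _).1 (b i).2).2
    have hbv : ∀ i, ⟪(b i : E), v⟫_ℝ = 0 := fun i => by rw [real_inner_comm]; exact hvb i
    have hbw : ∀ i, ⟪(b i : E), w⟫_ℝ = 0 := fun i => by rw [real_inner_comm]; exact hwb i
    refine ⟨Sum.elim (Fin.cons v fun j => (b (Sum.inl j) : E))
      (Fin.cons w fun j => (b (Sum.inr j) : E)), Fin.cons d d', ?_, ?_, ?_, ?_⟩
    · rw [orthonormal_iff_ite]
      rintro (i | i) (j | j) <;> refine Fin.cases ?_ (fun i => ?_) i <;>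
        refine Fin.cases ?_ (fun j => ?_) j <;>
        simp [hv, hw, hvw, hwv, hvb, hwb, hbv, hbw, hbi, (Fin.succ_ne_zero _).symm]
    · exact Fin.cases hd hd'
    · refine Fin.cases hTv fun j => ?_
      simpa using congrArg Subtype.val (h1 j)
    · refine Fin.cases hTw fun j => ?_
      simpa using congrArg Subtype.val (h2 j)

/-- The skew-symmetric matrix with blocks `±diag d` off the diagonal. -/
def skewBlock {n : ℕ} (d : Fin n → ℝ) : Matrix (Fin n ⊕ Fin n) (Fin n ⊕ Fin n) ℝ :=
  Matrix.fromBlocks 0 (-Matrix.diagonal d) (Matrix.diagonal d) 0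

theorem J_mul_diagonal {n : ℕ} (d : Fin n → ℝ) :
    Matrix.J (Fin n) ℝ * Matrix.diagonal (Sum.elim d d) = skewBlock d := by
  rw [Matrix.J, ← Matrix.fromBlocks_diagonal, Matrix.fromBlocks_multiply]
  simp [skewBlock]

theorem diagonal_mul_J {n : ℕ} (d : Fin n → ℝ) :
    Matrix.diagonal (Sum.elim d d) * Matrix.J (Fin n) ℝ = skewBlock d := by
  rw [Matrix.J, ← Matrix.fromBlocks_diagonal, Matrix.fromBlocks_multiply]
  simp [skewBlock]

theorem J_mem_unitaryGroup (n : ℕ) : Matrix.J (Fin n) ℝ ∈ Matrix.unitaryGroup (Fin n ⊕ Fin n) ℝ := by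
  rw [Matrix.mem_unitaryGroup_iff, Matrix.star_eq_conjTranspose,
    Matrix.conjTranspose_eq_transpose_of_trivial, Matrix.J_transpose, mul_neg, Matrix.J_squared,
    neg_neg]

/-- The orthogonal normal form of a skew-symmetric matrix. -/
theorem exists_skewBlock {n : ℕ} {K : Matrix (Fin n ⊕ Fin n) (Fin n ⊕ Fin n) ℝ} (hK : Kᵀ = -K) :
    ∃ O ∈ Matrix.unitaryGroup (Fin n ⊕ Fin n) ℝ, ∃ d : Fin n → ℝ, Monotone d ∧ (∀ j, 0 ≤ d j) ∧
      K = O * skewBlock d * star O := by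
  let T : EuclideanSpace ℝ (Fin n ⊕ Fin n) →ₗ[ℝ] EuclideanSpace ℝ (Fin n ⊕ Fin n) :=
    Matrix.toLpLin 2 2 K
  have hT : ∀ x y, ⟪T x, y⟫_ℝ = -⟪x, T y⟫_ℝ := fun x y => by
    simp only [T, EuclideanSpace.inner_eq_star_dotProduct, Matrix.ofLp_toLpLin, Matrix.toLin'_apply, star_trivial]
    rw [Matrix.dotProduct_mulVec, ← Matrix.mulVec_transpose, hK, Matrix.neg_mulVec,
      neg_dotProduct, dotProduct_comm]
  obtain ⟨b₀, d₀, hb₀, hd₀, h1₀, h2₀⟩ := exists_skew_basis n T hT (by simp)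
  let σ := Tuple.sort d₀
  let b : Fin n ⊕ Fin n → EuclideanSpace ℝ (Fin n ⊕ Fin n) := b₀ ∘ Sum.map σ σ
  let d := d₀ ∘ σ
  have hb : Orthonormal ℝ b := hb₀.comp _ (Sum.map_injective.2 ⟨σ.injective, σ.injective⟩)
  have h1 : ∀ j, T (b (Sum.inl j)) = d j • b (Sum.inr j) := fun j => h1₀ (σ j)
  have h2 : ∀ j, T (b (Sum.inr j)) = -(d j • b (Sum.inl j)) := fun j => h2₀ (σ j)
  let O : Matrix (Fin n ⊕ Fin n) (Fin n ⊕ Fin n) ℝ := Matrix.of fun i k => b k i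
  have hO : star O * O = 1 := by
    ext i k
    have := (orthonormal_iff_ite.1 hb) k i
    rw [EuclideanSpace.inner_eq_star_dotProduct] at this
    simp only [star_trivial] at this
    simp only [Matrix.mul_apply, Matrix.star_apply, O, Matrix.of_apply, star_trivial,
      Matrix.one_apply, eq_comm (a := i)]
    exact this
  have hOm : O ∈ Matrix.unitaryGroup (Fin n ⊕ Fin n) ℝ := Matrix.mem_unitaryGroup_iff'.2 hO
  have hKb : ∀ i k, (K * O) i k = T (b k) i := fun i k => by
    simp only [T, Matrix.ofLp_toLpLin, Matrix.toLin'_apply, Matrix.mul_apply, O,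
      Matrix.of_apply, Matrix.mulVec, dotProduct]
  have hKO : K * O = O * skewBlock d := by
    ext i k
    rw [hKb]
    rcases k with k | k
    · rw [h1, Matrix.mul_apply, Fintype.sum_sum_type]
      simp [skewBlock, O, Matrix.diagonal_apply, mul_comm]
    · rw [h2, Matrix.mul_apply, Fintype.sum_sum_type]
      simp [skewBlock, O, Matrix.diagonal_apply, mul_comm]
  refine ⟨O, hOm, d, Tuple.monotone_sort d₀, fun j => hd₀ _, ?_⟩
  rw [← hKO, mul_assoc, Matrix.unitaryGroup_mul_star_self hOm, mul_one]

end SkewNormalForm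

/-! ### Williamson's theorem through the skew-symmetric matrix √A J √A. -/

section Williamson

variable {n : ℕ}

theorem sqrt_J_sqrt_transpose (A : Matrix (Fin n ⊕ Fin n) (Fin n ⊕ Fin n) ℝ) :
    (CFC.sqrt A * Matrix.J (Fin n) ℝ * CFC.sqrt A)ᵀ = -(CFC.sqrt A * Matrix.J (Fin n) ℝ * CFC.sqrt A) := by
  have hS : (CFC.sqrt A)ᵀ = CFC.sqrt A := by
    rw [← Matrix.conjTranspose_eq_transpose_of_trivial]
    exact (Matrix.nonneg_iff_posSemidef.1 (CFC.sqrt_nonneg A)).isHermitian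
  rw [Matrix.transpose_mul, Matrix.transpose_mul, hS, Matrix.J_transpose]
  simp [mul_assoc]

/-- **Williamson's theorem** (existence). -/
theorem exists_isSymplecticSpectrum {A : Matrix (Fin n ⊕ Fin n) (Fin n ⊕ Fin n) ℝ}
    (hA : A.PosDef) : ∃ d, IsSymplecticSpectrum A d := by
  obtain ⟨O, hO, d, hd, hd0, hK⟩ := exists_skewBlock (sqrt_J_sqrt_transpose A)
  set S := CFC.sqrt A with hS
  have hSd : S.PosDef := hA.sqrt_posDef
  have hSS : S * S = A := CFC.sqrt_mul_sqrt_self _ hA.posSemidef.nonneg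
  have hSu : IsUnit S.det := (Matrix.isUnit_iff_isUnit_det S).1 hSd.isUnit
  have hOO := Matrix.unitaryGroup_star_mul_self hO
  -- S J S is invertible, whereas some `d j` = 0 would give `skewBlock d` a zero column.
  have hdet : (skewBlock d).det ≠ 0 := by
    intro h0
    have h1 := congrArg Matrix.det hK
    rw [Matrix.det_mul, Matrix.det_mul, Matrix.det_mul, Matrix.det_mul, h0] at h1
    have h2 := (hSu.mul (Matrix.isUnit_det_J (Fin n) ℝ)).mul hSu
    rw [h1] at h2
    simp at h2
  have hdpos : ∀ j, 0 < d j := fun j => (hd0 j).lt_of_ne' fun h0 => hdet <| by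
    refine Matrix.det_eq_zero_of_column_eq_zero (Sum.inl j) fun i => ?_
    rcases i with i | i
    · simp [skewBlock]
    · by_cases hij : i = j
      · simp [skewBlock, hij, h0]
      · simp [skewBlock, hij]
  -- Δ = diag(D, D)^{1/2} commutes with J, so M = S⁻¹ O Δ satisfies M J Mᵀ = S⁻¹ (S J S) S⁻¹ = J,
  -- and Mᵀ A M = Δ².
  let Δ : Matrix (Fin n ⊕ Fin n) (Fin n ⊕ Fin n) ℝ :=
    Matrix.diagonal (Sum.elim (fun j => √(d j)) fun j => √(d j))
  have hΔT : Δᵀ = Δ := Matrix.diagonal_transpose _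
  have hΔΔ : Δ * Δ = Matrix.diagonal (Sum.elim d d) := by
    rw [Matrix.diagonal_mul_diagonal]
    congr 1
    ext i
    rcases i with i | i <;> simp [Real.mul_self_sqrt (hd0 i)]
  have hΔJ : Δ * Matrix.J (Fin n) ℝ = Matrix.J (Fin n) ℝ * Δ := by
    rw [J_mul_diagonal, diagonal_mul_J]
  have hSiT : (S⁻¹)ᵀ = S⁻¹ := by
    rw [← Matrix.conjTranspose_eq_transpose_of_trivial]; exact hSd.inv.isHermitian
  have h1 : S * S⁻¹ = 1 := S.mul_nonsing_inv hSu
  have h2 : S⁻¹ * S = 1 := S.nonsing_inv_mul hSu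
  rw [Matrix.star_eq_conjTranspose, Matrix.conjTranspose_eq_transpose_of_trivial] at hK hOO
  refine ⟨d, hd, hdpos, S⁻¹ * O * Δ, ?_, ?_⟩
  · rw [SymplecticGroup.mem_iff]
    rw [Matrix.transpose_mul, Matrix.transpose_mul, hSiT, hΔT]
    calc S⁻¹ * O * Δ * Matrix.J (Fin n) ℝ * (Δ * (Oᵀ * S⁻¹))
        = S⁻¹ * (O * (Δ * Matrix.J (Fin n) ℝ * Δ) * Oᵀ) * S⁻¹ := by simp only [mul_assoc]
      _ = S⁻¹ * (S * Matrix.J (Fin n) ℝ * S) * S⁻¹ := by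
        rw [hΔJ, mul_assoc _ Δ Δ, hΔΔ, J_mul_diagonal, hK]
      _ = (S⁻¹ * S) * Matrix.J (Fin n) ℝ * (S * S⁻¹) := by simp only [mul_assoc]
      _ = Matrix.J (Fin n) ℝ := by rw [h1, h2, one_mul, mul_one]
  · rw [Matrix.transpose_mul, Matrix.transpose_mul, hSiT, hΔT, ← hSS]
    calc Δ * (Oᵀ * S⁻¹) * (S * S) * (S⁻¹ * O * Δ)
        = Δ * (Oᵀ * (S⁻¹ * S) * (S * S⁻¹) * O) * Δ := by simp only [mul_assoc]
      _ = Δ * Δ := by rw [h1, h2, mul_one, mul_one, hOO, mul_one]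
      _ = _ := by rw [hΔΔ, Matrix.fromBlocks_diagonal]

/-- The symplectic spectrum in terms of the skew-symmetric matrix `√A J √A`. -/
theorem IsSymplecticSpectrum.exists_skewBlock {A : Matrix (Fin n ⊕ Fin n) (Fin n ⊕ Fin n) ℝ}
    (hA : A.PosDef) {d : Fin n → ℝ} (h : IsSymplecticSpectrum A d) :
    ∃ O ∈ Matrix.unitaryGroup (Fin n ⊕ Fin n) ℝ,
      CFC.sqrt A * Matrix.J (Fin n) ℝ * CFC.sqrt A = O * skewBlock d * star O := by
  obtain ⟨-, hd, M, hM, hMA⟩ := h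
  set S := CFC.sqrt A with hS
  have hSS : S * S = A := CFC.sqrt_mul_sqrt_self _ hA.posSemidef.nonneg
  have hST : Sᵀ = S := by
    rw [← Matrix.conjTranspose_eq_transpose_of_trivial]; exact hA.sqrt_posDef.isHermitian
  rw [SymplecticGroup.mem_iff] at hM
  rw [Matrix.fromBlocks_diagonal] at hMA
  let r : Fin n → ℝ := fun j => (√(d j))⁻¹
  let Δ : Matrix (Fin n ⊕ Fin n) (Fin n ⊕ Fin n) ℝ := Matrix.diagonal (Sum.elim r r)
  let Δ' : Matrix (Fin n ⊕ Fin n) (Fin n ⊕ Fin n) ℝ :=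
    Matrix.diagonal (Sum.elim (fun j => √(d j)) fun j => √(d j))
  have hs : ∀ j, √(d j) ≠ 0 := fun j => (Real.sqrt_pos.2 (hd j)).ne'
  have hΔT : Δᵀ = Δ := Matrix.diagonal_transpose _
  have hΔ : Δ * Δ' = 1 := by
    rw [Matrix.diagonal_mul_diagonal, ← Matrix.diagonal_one]
    congr 1
    ext i
    rcases i with i | i <;> simp [r, hs i]
  have hΔd : Δ * Matrix.diagonal (Sum.elim d d) * Δ = 1 := by
    rw [Matrix.diagonal_mul_diagonal, Matrix.diagonal_mul_diagonal, ← Matrix.diagonal_one]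
    congr 1
    ext i
    have hi : ∀ j, (√(d j))⁻¹ * d j * (√(d j))⁻¹ = 1 := fun j => by
      nth_rewrite 2 [← Real.mul_self_sqrt (hd j).le]
      field_simp [hs j]
    rcases i with i | i <;> simp [r, hi]
  have hLD : Δ * skewBlock d * Δ = Matrix.J (Fin n) ℝ := by
    rw [← J_mul_diagonal, ← mul_assoc, diagonal_mul_J, ← J_mul_diagonal, mul_assoc, mul_assoc,
      ← mul_assoc _ _ Δ, hΔd, mul_one]
  -- The existence construction M = S⁻¹ O Δ' solved for O, with Δ the inverse of Δ'. Orthogonality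
  -- is the equation Mᵀ A M = diag(D, D), and the normal form is M J Mᵀ = J.
  refine ⟨S * M * Δ, ?_, ?_⟩
  · rw [Matrix.mem_unitaryGroup_iff', Matrix.star_eq_conjTranspose,
      Matrix.conjTranspose_eq_transpose_of_trivial, Matrix.transpose_mul, Matrix.transpose_mul,
      hST, hΔT]
    calc Δ * (Mᵀ * S) * (S * M * Δ) = Δ * (Mᵀ * (S * S) * M) * Δ := by simp only [mul_assoc]
      _ = 1 := by rw [hSS, hMA, hΔd]
  · rw [Matrix.star_eq_conjTranspose, Matrix.conjTranspose_eq_transpose_of_trivial,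
      Matrix.transpose_mul, Matrix.transpose_mul, hST, hΔT]
    calc S * Matrix.J (Fin n) ℝ * S = S * (M * Matrix.J (Fin n) ℝ * Mᵀ) * S := by rw [hM]
      _ = S * (M * (Δ * skewBlock d * Δ) * Mᵀ) * S := by rw [hLD]
      _ = S * M * Δ * skewBlock d * (Δ * (Mᵀ * S)) := by simp only [mul_assoc]

/-- Uniqueness of the list plays no role: the estimates use only that the chosen list satisfies the
defining property. -/
theorem isSymplecticSpectrum_symplecticEigenvalues
    {A : Matrix (Fin n ⊕ Fin n) (Fin n ⊕ Fin n) ℝ} (hA : A.PosDef) :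
    IsSymplecticSpectrum A (symplecticEigenvalues A) := by
  have h := exists_isSymplecticSpectrum hA
  rw [symplecticEigenvalues, dif_pos h]
  exact h.choose_spec

end Williamson

/-! ### Perturbation of symplectic eigenvalues through Hermitian matrices i·K. -/

section Perturbation

variable {n : ℕ}

/-- The unitary matrix diagonalizing `i * skewBlock d`. -/
noncomputable def skewBlockUnitary (n : ℕ) : Matrix (Fin n ⊕ Fin n) (Fin n ⊕ Fin n) ℂ :=
  ((√2)⁻¹ : ℂ) • Matrix.fromBlocks 1 1 (Complex.I • 1) (-(Complex.I • 1))

theorem star_skewBlockUnitary (n : ℕ) : star (skewBlockUnitary n) =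
    ((√2)⁻¹ : ℂ) • Matrix.fromBlocks 1 (-(Complex.I • 1)) 1 (Complex.I • 1) := by
  rw [skewBlockUnitary, Matrix.star_eq_conjTranspose, Matrix.conjTranspose_smul,
    Matrix.fromBlocks_conjTranspose]
  simp

theorem inv_sqrt_two_mul_self : ((√2)⁻¹ : ℂ) * ((√2)⁻¹ : ℂ) = 2⁻¹ := by
  rw [← mul_inv, ← Complex.ofReal_mul, Real.mul_self_sqrt zero_le_two]; simp

theorem skewBlockUnitary_mem (n : ℕ) :
    skewBlockUnitary n ∈ Matrix.unitaryGroup (Fin n ⊕ Fin n) ℂ := by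
  rw [Matrix.mem_unitaryGroup_iff, star_skewBlockUnitary, skewBlockUnitary, smul_mul_smul_comm,
    inv_sqrt_two_mul_self, Matrix.fromBlocks_multiply, Matrix.fromBlocks_smul,
    ← Matrix.fromBlocks_one]
  congr 1 <;> simp [smul_smul, ← two_smul ℂ (1 : Matrix (Fin n) (Fin n) ℂ)]

/-- The columns (e_j, ±i e_j)/√2 are eigenvectors of i·`skewBlock d` for ±d_j. -/
theorem diagConj_skewBlockUnitary (d : Fin n → ℝ) :
    diagConj (skewBlockUnitary n) (Sum.elim d (-d)) =
      Complex.I • (skewBlock d).map (algebraMap ℝ ℂ) := by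
  have h : (Matrix.diagonal fun i => ((Sum.elim d (-d) i : ℝ) : ℂ)) =
      Matrix.fromBlocks (Matrix.diagonal fun j => (d j : ℂ)) 0 0
        (-Matrix.diagonal fun j => (d j : ℂ)) := by
    rw [Matrix.diagonal_neg, Matrix.fromBlocks_diagonal]
    congr 1
    ext i
    rcases i with i | i <;> simp
  rw [diagConj, star_skewBlockUnitary, skewBlockUnitary]
  have h' : (Matrix.diagonal fun i => ((Sum.elim d (-d) i : ℝ) : ℂ)) =
    (Matrix.diagonal fun i => (RCLike.ofReal (Sum.elim d (-d) i : ℝ) : ℂ)) := rfl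
  rw [← h', h, smul_mul_assoc, smul_mul_smul_comm, inv_sqrt_two_mul_self,
    Matrix.fromBlocks_multiply, Matrix.fromBlocks_multiply, skewBlock, Matrix.fromBlocks_map,
    Matrix.fromBlocks_smul, Matrix.fromBlocks_smul]
  congr 1
  all_goals
    ext i j
    by_cases hij : i = j <;> simp [hij]
    try ring

theorem diagConj_map_mul_skewBlockUnitary (O : Matrix (Fin n ⊕ Fin n) (Fin n ⊕ Fin n) ℝ)
    (d : Fin n → ℝ) :
    diagConj (O.map (algebraMap ℝ ℂ) * skewBlockUnitary n) (Sum.elim d (-d)) =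
      Complex.I • (O * skewBlock d * star O).map (algebraMap ℝ ℂ) := by
  have h1 : diagConj (O.map (algebraMap ℝ ℂ) * skewBlockUnitary n) (Sum.elim d (-d)) =
      O.map (algebraMap ℝ ℂ) * diagConj (skewBlockUnitary n) (Sum.elim d (-d)) *
        star (O.map (algebraMap ℝ ℂ)) := by
    simp only [diagConj, star_mul, mul_assoc]
  have h2 : star (O.map (algebraMap ℝ ℂ)) = (star O).map (algebraMap ℝ ℂ) := by
    ext i j; simp
  rw [h1, diagConj_skewBlockUnitary, h2, Matrix.map_mul, Matrix.map_mul, mul_smul_comm,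
    smul_mul_assoc]

theorem Matrix.map_mem_unitaryGroup {𝕜 m : Type*} [RCLike 𝕜] [Fintype m] [DecidableEq m]
    {O : Matrix m m ℝ} (hO : O ∈ Matrix.unitaryGroup m ℝ) :
    O.map (algebraMap ℝ 𝕜) ∈ Matrix.unitaryGroup m 𝕜 := by
  have h2 : star (O.map (algebraMap ℝ 𝕜)) = (star O).map (algebraMap ℝ 𝕜) := by
    ext i j; simp
  rw [Matrix.mem_unitaryGroup_iff, h2, ← Matrix.map_mul, Matrix.unitaryGroup_mul_star_self hO]
  simp

/-- An enumeration along which `Sum.elim d (-d)` decreases for increasing `d`. -/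
def decreasingEnum (n : ℕ) : Fin n ⊕ Fin n ≃ Fin (n + n) :=
  (Equiv.sumCongr Fin.revPerm (Equiv.refl _)).trans finSumFinEquiv

theorem antitone_decreasingEnum {d : Fin n → ℝ} (hd : Monotone d) (hd0 : ∀ j, 0 ≤ d j)
    (i j : Fin n ⊕ Fin n) (hij : decreasingEnum n i ≤ decreasingEnum n j) :
    (Sum.elim d (-d) : Fin n ⊕ Fin n → ℝ) j ≤ (Sum.elim d (-d) : Fin n ⊕ Fin n → ℝ) i := by
  rcases i with i | i <;> rcases j with j | j
  · have h : Fin.castAdd n i.rev ≤ Fin.castAdd n j.rev := by simpa [decreasingEnum] using hij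
    exact hd (Fin.rev_le_rev.1 h)
  · have h1 := hd0 i
    have h2 := hd0 j
    simp only [Sum.elim_inl, Sum.elim_inr, Pi.neg_apply]
    linarith
  · exfalso
    simp only [decreasingEnum, Equiv.trans_apply, Equiv.sumCongr_apply, Sum.map_inr, Sum.map_inl,
      Equiv.refl_apply, finSumFinEquiv_apply_right, finSumFinEquiv_apply_left, Fin.le_def,
      Fin.val_natAdd, Fin.val_castAdd] at hij
    have := (Fin.revPerm j).2
    omega
  · refine neg_le_neg (hd ?_)
    simpa [decreasingEnum] using hij

/-- Lidskii–Mirsky–Wielandt for the Hermitian matrices i·K. In decreasing order the eigenvalues ±a_j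
and ±b_j match index by index, so the differences are ±(a_j - b_j), and their excesses add up to
that of |a_j - b_j|. -/
theorem sum_abs_sub_excess_le {O₁ O₂ O₃ : Matrix (Fin n ⊕ Fin n) (Fin n ⊕ Fin n) ℝ}
    (h₁ : O₁ ∈ Matrix.unitaryGroup _ ℝ) (h₂ : O₂ ∈ Matrix.unitaryGroup _ ℝ)
    (h₃ : O₃ ∈ Matrix.unitaryGroup _ ℝ) {a b δ : Fin n → ℝ}
    (ha : Monotone a) (ha0 : ∀ j, 0 ≤ a j) (hb : Monotone b) (hb0 : ∀ j, 0 ≤ b j)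
    (hδ : ∀ j, 0 ≤ δ j)
    (h : O₁ * skewBlock a * star O₁ - O₂ * skewBlock b * star O₂ = O₃ * skewBlock δ * star O₃)
    {t : ℝ} (ht : 0 < t) :
    ∑ j, max (|a j - b j| - t) 0 ≤ ∑ j, max (δ j - t) 0 := by
  have hW := skewBlockUnitary_mem n
  have key := sum_eigenvalue_sub_excess_le (mul_mem (Matrix.map_mem_unitaryGroup h₁) hW)
    (mul_mem (Matrix.map_mem_unitaryGroup h₂) hW) (mul_mem (Matrix.map_mem_unitaryGroup h₃) hW)
    (a := Sum.elim a (-a)) (b := Sum.elim b (-b)) (h := Sum.elim δ (-δ))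
    (by
      rw [diagConj_map_mul_skewBlockUnitary, diagConj_map_mul_skewBlockUnitary,
        diagConj_map_mul_skewBlockUnitary, ← smul_sub, ← h]
      congr 1
      ext i j; simp)
    (decreasingEnum n) (antitone_decreasingEnum ha ha0) (antitone_decreasingEnum hb hb0) t
  simp only [Fintype.sum_sum_type, Sum.elim_inl, Sum.elim_inr, Pi.neg_apply] at key
  -- The nonpositive half of the spectrum ±δ has no excess over t > 0.
  have h0 : ∑ j, max (-δ j - t) 0 = 0 :=
    Finset.sum_eq_zero fun j _ => max_eq_right (by linarith [hδ j])
  rw [h0, add_zero, ← Finset.sum_add_distrib] at key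
  refine le_trans (le_of_eq (Finset.sum_congr rfl fun j _ => ?_)) key
  rw [max_abs_sub_eq ht, neg_sub, neg_sub_neg]

end Perturbation

/-! ### The doubled spectrum and the main estimate. -/

section DoubledSpectrum

variable {n : ℕ}

theorem sum_half_rev {M : Type*} [AddCommMonoid M] (G : Fin n → M) :
    ∑ i : Fin n ⊕ Fin n, G (Fin.rev ⟨(finSumFinEquiv i).val / 2, by omega⟩) = ∑ j, (G j + G j) := by
  have e : n * 2 = n + n := by ring
  rw [Equiv.sum_comp finSumFinEquiv fun k : Fin (n + n) => G (Fin.rev ⟨k.val / 2, by omega⟩),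
    -- A position is written as 2j + k with k in {0, 1}; halving forgets k, hence the doubling.
    ← Equiv.sum_comp (finCongr e), ← Equiv.sum_comp finProdFinEquiv, Fintype.sum_prod_type,
    ← Equiv.sum_comp Fin.revPerm]
  refine Finset.sum_congr rfl fun j _ => ?_
  rw [Fin.sum_univ_two]
  have h : ∀ k : Fin 2, ∀ hk, (⟨(finCongr e (finProdFinEquiv (Fin.revPerm j, k))).val / 2, hk⟩ : Fin n) =
      Fin.rev j := fun k hk => by
    ext
    have := k.2
    simp only [finCongr_apply, Fin.val_cast, finProdFinEquiv_apply_val, Fin.revPerm_apply]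
    omega
  rw [h, h, Fin.rev_rev]

theorem DHat_sub (A B : Matrix (Fin n ⊕ Fin n) (Fin n ⊕ Fin n) ℝ) :
    DHat A - DHat B = Matrix.diagonal fun i => dHat A (finSumFinEquiv i) - dHat B (finSumFinEquiv i) := by
  rw [DHat, DHat, Matrix.diagonal_sub]

theorem sum_dHat_sub {M : Type*} [AddCommMonoid M] (F : ℝ → M)
    (A B : Matrix (Fin n ⊕ Fin n) (Fin n ⊕ Fin n) ℝ) :
    ∑ i, F (dHat A (finSumFinEquiv i) - dHat B (finSumFinEquiv i)) =
      ∑ j, (F (symplecticEigenvalues A j - symplecticEigenvalues B j) +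
        F (symplecticEigenvalues A j - symplecticEigenvalues B j)) :=
  sum_half_rev fun j => F (symplecticEigenvalues A j - symplecticEigenvalues B j)

theorem exists_dHat_sub_eq (A B : Matrix (Fin n ⊕ Fin n) (Fin n ⊕ Fin n) ℝ) (j : Fin n) :
    ∃ i, dHat A (finSumFinEquiv i) - dHat B (finSumFinEquiv i) =
      symplecticEigenvalues A j - symplecticEigenvalues B j := by
  refine ⟨finSumFinEquiv.symm ⟨2 * (Fin.rev j).val, by omega⟩, ?_⟩
  have h : ∀ hk, Fin.rev (⟨2 * (Fin.rev j).val / 2, hk⟩ : Fin n) = j := fun hk => by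
    rw [Fin.rev_eq_iff]; ext; simp
  simp only [dHat, Equiv.apply_symm_apply, h]

theorem Matrix.PosSemidef.norm_sqrt {m : Type*} [Fintype m] [DecidableEq m] {A : Matrix m m ℝ}
    (hA : A.PosSemidef) : ‖CFC.sqrt A‖ = √‖A‖ := by
  have hS := (Matrix.nonneg_iff_posSemidef.1 (CFC.sqrt_nonneg A)).isHermitian
  have h := Matrix.l2_opNorm_conjTranspose_mul_self (CFC.sqrt A)
  rw [hS.eq, CFC.sqrt_mul_sqrt_self A hA.nonneg] at h
  rw [h, Real.sqrt_mul_self (norm_nonneg _)]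

theorem IsOrthogonallyInvariant.DHat_sub_le {p : Seminorm ℝ (Matrix (Fin n ⊕ Fin n) (Fin n ⊕ Fin n) ℝ)}
    (hp : IsOrthogonallyInvariant p) {A B : Matrix (Fin n ⊕ Fin n) (Fin n ⊕ Fin n) ℝ}
    (hA : A.PosDef) (hB : B.PosDef) :
    p (DHat A - DHat B) ≤ (√‖A‖ + √‖B‖) * p (CFC.sqrt (CFC.abs (A - B))) := by
  have sA := isSymplecticSpectrum_symplecticEigenvalues hA
  have sB := isSymplecticSpectrum_symplecticEigenvalues hB
  obtain ⟨O₁, h₁, e₁⟩ := sA.exists_skewBlock hA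
  obtain ⟨O₂, h₂, e₂⟩ := sB.exists_skewBlock hB
  set S := CFC.sqrt A with hS
  set T := CFC.sqrt B with hT
  set J := Matrix.J (Fin n) ℝ with hJ
  have hK : (S * J * S - T * J * T)ᵀ = -(S * J * S - T * J * T) := by
    rw [Matrix.transpose_sub, sqrt_J_sqrt_transpose, sqrt_J_sqrt_transpose]; abel
  obtain ⟨O₃, h₃, δ, -, hδ, e₃⟩ := exists_skewBlock hK
  -- Up to orthogonal factors, one of them J itself, the right side is diag(δ, δ), so Fan dominance
  -- between diagonal matrices suffices.
  have hle : p (DHat A - DHat B) ≤ p (S * J * S - T * J * T) := by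
    rw [e₃, hp _ h₃ _ (Matrix.star_mem_unitaryGroup h₃), ← J_mul_diagonal,
      hp.mul_left (J_mem_unitaryGroup n), DHat_sub]
    refine hp.diagonal_le_of_excess fun t ht => ?_
    rw [sum_dHat_sub fun x => max (|x| - t) 0, Finset.sum_add_distrib, Fintype.sum_sum_type]
    simp only [Sum.elim_inl, Sum.elim_inr, abs_of_nonneg (hδ _)]
    have := sum_abs_sub_excess_le h₁ h₂ h₃ sA.1 (fun j => (sA.2.1 j).le) sB.1
      (fun j => (sB.2.1 j).le) hδ (by rw [← e₁, ← e₂, e₃]) ht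
    exact add_le_add this this
  -- Inserting S J T places S - T in each term beside the orthogonal J, with a single outer factor S
  -- or T to be bounded by its operator norm.
  have hsplit : S * J * S - T * J * T = S * (J * (S - T)) + ((S - T) * J) * T := by
    noncomm_ring
  have hSH : S.IsHermitian := hA.sqrt_posDef.isHermitian
  have hTH : T.IsHermitian := hB.sqrt_posDef.isHermitian
  calc p (DHat A - DHat B) ≤ p (S * (J * (S - T))) + p (((S - T) * J) * T) :=
        hle.trans (hsplit ▸ map_add_le_add p _ _)
    _ ≤ ‖S‖ * p (J * (S - T)) + ‖T‖ * p ((S - T) * J) :=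
        add_le_add (hp.hermitian_mul_le hSH _) (hp.mul_hermitian_le hTH _)
    _ = (√‖A‖ + √‖B‖) * p (S - T) := by
      rw [hp.mul_left (J_mem_unitaryGroup n), hp.mul_right (J_mem_unitaryGroup n), hS, hT,
        Matrix.PosSemidef.norm_sqrt hA.posSemidef, Matrix.PosSemidef.norm_sqrt hB.posSemidef, add_mul]
    _ ≤ _ := mul_le_mul_of_nonneg_left (hp.sqrt_sub_sqrt_le hA hB) (by positivity)

end DoubledSpectrum

/-! ### Unitarily invariant, operator and Frobenius norms as orthogonally invariant seminorms. -/

section ParticularNorms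

variable {m : Type*} [Fintype m] [DecidableEq m]

/-- Orthogonal matrices become unitary over 𝕜, so pulling the norm back to real matrices treats both
scalar fields at once. -/
theorem IsUnitarilyInvariantNorm.isOrthogonallyInvariant {𝕜 : Type*} [RCLike 𝕜]
    {N : Seminorm 𝕜 (Matrix m m 𝕜)} (hN : IsUnitarilyInvariantNorm N) :
    IsOrthogonallyInvariant
      ((N.restrictScalars ℝ).comp (Algebra.linearMap ℝ 𝕜).mapMatrix) := by
  intro U hU V hV X
  change N ((U * X * V).map (algebraMap ℝ 𝕜)) = N (X.map (algebraMap ℝ 𝕜))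
  rw [Matrix.map_mul, Matrix.map_mul]
  exact hN.2 _ (Matrix.map_mem_unitaryGroup hU) _ (Matrix.map_mem_unitaryGroup hV) _

theorem isOrthogonallyInvariant_opNorm :
    IsOrthogonallyInvariant (normSeminorm ℝ (Matrix m m ℝ)) := by
  intro U hU V hV X
  exact (CStarRing.norm_mul_mem_unitary (U * X) hV).trans (CStarRing.norm_mem_unitary_mul X hU)

/-- The Frobenius norm as a seminorm. -/
noncomputable def frobeniusSeminorm (m : Type*) [Fintype m] : Seminorm ℝ (Matrix m m ℝ) :=
  (normSeminorm ℝ (EuclideanSpace ℝ (m × m))).comp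
    ({ toFun := fun X => WithLp.toLp 2 fun ij => X ij.1 ij.2
       map_add' := fun _ _ => rfl
       map_smul' := fun _ _ => rfl } : Matrix m m ℝ →ₗ[ℝ] EuclideanSpace ℝ (m × m))

omit [DecidableEq m] in
theorem frobeniusSeminorm_apply (X : Matrix m m ℝ) :
    frobeniusSeminorm m X = √(star X * X).trace := by
  change ‖(WithLp.toLp 2 fun ij : m × m => X ij.1 ij.2 : EuclideanSpace ℝ (m × m))‖ = _
  rw [EuclideanSpace.norm_eq]
  congr 1
  rw [Fintype.sum_prod_type, Finset.sum_comm]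
  simp [Matrix.trace, Matrix.mul_apply, sq]

theorem isOrthogonallyInvariant_frobeniusSeminorm :
    IsOrthogonallyInvariant (frobeniusSeminorm m) := by
  intro U hU V hV X
  rw [frobeniusSeminorm_apply, frobeniusSeminorm_apply]
  congr 1
  calc (star (U * X * V) * (U * X * V)).trace
      = (star V * (star X * (star U * U) * X * V)).trace := by
        simp only [star_mul, mul_assoc]
    _ = (star X * X).trace := by
      rw [Matrix.unitaryGroup_star_mul_self hU, mul_one, Matrix.trace_mul_comm, mul_assoc,
        Matrix.unitaryGroup_mul_star_self hV, mul_one]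

end ParticularNorms

theorem theorem7 (n : ℕ) (A B : Matrix (Fin n ⊕ Fin n) (Fin n ⊕ Fin n) ℝ)
    (hA : A.PosDef) (hB : B.PosDef) :
    (∀ (𝕜 : Type*) [RCLike 𝕜] (N : Seminorm 𝕜 (Matrix (Fin n ⊕ Fin n) (Fin n ⊕ Fin n) 𝕜)),
      IsUnitarilyInvariantNorm N →
        N ((DHat A - DHat B).map (algebraMap ℝ 𝕜)) ≤
          (√‖A‖ + √‖B‖) * N ((CFC.sqrt (CFC.abs (A - B))).map (algebraMap ℝ 𝕜))) ∧
    (⨆ j : Fin n, |symplecticEigenvalues A j - symplecticEigenvalues B j|) ≤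
      (√‖A‖ + √‖B‖) * √‖A - B‖ ∧
    √2 * √(∑ j : Fin n, |symplecticEigenvalues A j - symplecticEigenvalues B j| ^ 2) ≤
      (√‖A‖ + √‖B‖) * √(CFC.abs (A - B)).trace := by
  have habs : (CFC.abs (A - B)).PosSemidef := Matrix.nonneg_iff_posSemidef.1 (CFC.abs_nonneg _)
  refine ⟨fun 𝕜 _ N hN => hN.isOrthogonallyInvariant.DHat_sub_le hA hB, ?_, ?_⟩
  · have h : ‖DHat A - DHat B‖ ≤ (√‖A‖ + √‖B‖) * ‖CFC.sqrt (CFC.abs (A - B))‖ :=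
      isOrthogonallyInvariant_opNorm.DHat_sub_le hA hB
    rw [Matrix.PosSemidef.norm_sqrt habs, CFC.norm_abs, DHat_sub, Matrix.l2_opNorm_diagonal] at h
    -- The right side must also be nonnegative because for n = 0 the supremum of the empty family is
    -- 0.
    refine Real.iSup_le (fun j => le_trans ?_ h) (by positivity)
    obtain ⟨i, hi⟩ := exists_dHat_sub_eq A B j
    rw [← hi]
    exact norm_le_pi_norm (fun i => dHat A (finSumFinEquiv i) - dHat B (finSumFinEquiv i)) i
  · have h := isOrthogonallyInvariant_frobeniusSeminorm.DHat_sub_le hA hB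
    have hS := (Matrix.nonneg_iff_posSemidef.1 (CFC.sqrt_nonneg (CFC.abs (A - B)))).isHermitian
    rw [frobeniusSeminorm_apply, frobeniusSeminorm_apply, Matrix.star_eq_conjTranspose (CFC.sqrt _),
      hS.eq, CFC.sqrt_mul_sqrt_self _ habs.nonneg, DHat_sub, Matrix.star_eq_conjTranspose,
      Matrix.diagonal_conjTranspose, Matrix.diagonal_mul_diagonal, Matrix.trace_diagonal] at h
    -- The factor √2 reflects that each difference occurs twice on the diagonal of D̂(A) - D̂(B).
    rw [← Real.sqrt_mul zero_le_two]
    refine le_trans (le_of_eq ?_) h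
    congr 1
    rw [star_trivial, sum_dHat_sub fun x => x * x, Finset.mul_sum]
    exact Finset.sum_congr rfl fun j _ => by rw [sq_abs]; ring
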